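/- Consider the rank-six $U(1)$ tensorial field theory in momentum space, with gauge constraint set $\mathcal P=\{\vec p\in\mathbb Z^6:\sum_c p_c=0\}$, mass $m>0$, propagator with sharp ultraviolet cutoff $\rho\in\mathbb N$ (where $M>1$ is fixed) $$C^\rho(\vec p)=\frac{\delta(\sum_c p_c)\,\mathbf 1_{|\vec p|^2\le M^{2\rho}}}{|\vec p|^2+m^2},$$ and interaction $S_{int}=\lambda\sum_{c=1}^6 \mathrm{Tr}_{b_c}(\bar\phi\phi)$, where for $c=1$ $$\mathrm{Tr}_{b_1}(\bar\phi\phi)=\sum_{\vec p,\vec p\,'}\bar\phi(p_1,p_2,\dots,p_6)\,\phi(p'_1,p_2,\dots,p_6)\,\bar\phi(p'_1,p'_2,\dots,p'_6)\,\phi(p_1,p'_2,\dots,p'_6)$$ and similarly for the other colours. A vertex $b_c$ splits into two halves, each containing a $\bar\phi$ and a $\phi$ joined by the five strands of colours other than $c$. In the intermediate field representation the disks of a graph are the cyclic or open sequences of propagators and halves, each open one (ciliated disk) carrying one incoming and one outgoing external leg of equal momentum, and each vertex $b_c$ is a wavy edge of colour $c$ between the disks of its two halves. The vertex function $\Gamma_{2N}$,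 a function of the cutoff and of the momenta in $\mathcal P^N$ of the $N$ ciliated disks with values in $\mathbb R[[\lambda]]$, is the sum over connected one-particle irreducible amputated Feynman graphs with $N$ ciliated disks, the order $\lambda^n$ being $\frac{(-\lambda)^n}{n!}$ times the sum of the amplitudes of the graphs with $n$ labelled vertices. A graph is melonic if the 7-coloured graph obtained by joining the two external legs of each ciliated disk and giving colour $0$ to the propagators has degree zero (the degree is the sum of the genera of its jackets). A four-point graph is monocolour of colour $c$ if its two ciliated disks are joined by a path of wavy edges all of colour $c$. Let $\Gamma_2^{melo}$ be the part of $\Gamma_2$ coming from melonic graphs, $\Gamma_{4,mono}^{(c)}$ the part of $\Gamma_4$ coming from graphs monocolour of colour $c$, and $\Gamma_{4,mono}^{melo,(c)}$ the part of the latter coming from melonic graphs. The divergence degree of a graph is $\omega=-2L+F-R$, where $L$ is the number of internal lines, $F$ the number of internal faces and $R$ the rank of the line/internal-face incidence matrix. A sum of graphs is called superficially convergent if all its graphs have $\omega<0$. **Theorem.** There exist functions $f,g$ of the cutoff $\rho$ and of a single strand momentum $p\in\mathbb Z$, with values in $\mathbb R[[\lambda]]$, such that: 1. $f$ and $g$ are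 ultraviolet divergent: for every $p\in\mathbb Z$, the absolute value of the coefficient of $\lambda^k$ in $f(p)$ tends to $+\infty$ as $\rho\to\infty$ for every $k\ge 0$, and so does that of the coefficient of $\lambda^k$ in $g(p)$ for every $k\ge 1$ (the order $k=0$ of $g$ is the bare vertex); 2. for all $\rho$, all $\vec p,\vec p\,'\in\mathcal P$ and all colours $c$, $$\Gamma_2^{melo}(\vec p)=-\lambda\sum_{c'=1}^6 f(p_{c'}),\qquad \Gamma_{4,mono}^{melo,(c)}(\vec p,\vec p\,')=-\lambda\,\delta(p_c,p'_c)\,g(p_c).$$ Moreover $\Gamma_2-\Gamma_2^{melo}$ and, for every colour $c$, $\Gamma_{4,mono}^{(c)}-\Gamma_{4,mono}^{melo,(c)}$ are superficially convergent (being the sums of the corresponding non-melonic graphs). So is $\Gamma_4-\sum_{c}\Gamma_{4,mono}^{melo,(c)}$, the sum of the one-particle irreducible four-point graphs that are not both melonic and monocolour, and so are all the higher vertex functions $\Gamma_{2N}$, $N\ge 3$. -/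

import Mathlib

/-! Perturbation theory of the rank six `U(1)` tensorial field theory with gauge-invariant
Laplacian propagator and colour-symmetric quartic melonic interaction
`S_int = lam * ∑ c, Tr_{b_c}(φbar φ)`, in momentum space, with a sharp ultraviolet cutoff. -/

namespace TGFT

open Filter Topology

noncomputable section

/-- Momenta `(p_1, …, p_6)` of the six strands. -/
abbrev Momentum : Type := Fin 6 → ℤ

/-- Momenta satisfying the gauge constraint `∑ c, p_c = 0`. -/
abbrev GaugeMomentum : Type := {p : Momentum // ∑ c, p c = 0}

/-- The propagator `δ(∑ c, p_c) / (|p|² + m²)` with the sharp cutoff `|p|² ≤ M^(2ρ)`. -/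
def propagator (m M : ℝ) (ρ : ℕ) (p : Momentum) : ℝ :=
  if ∑ c, p c = 0 ∧ ∑ c, (p c : ℝ) ^ 2 ≤ M ^ (2 * ρ) then 1 / (∑ c, (p c : ℝ) ^ 2 + m ^ 2) else 0

/-- The two halves of each of `n` quartic vertices. The half `(v, i)` carries one white node
(a field `φbar`) and one black node (a field `φ`). -/
abbrev Half (n : ℕ) : Type := Fin n × Bool

/-- A labelled amputated Feynman graph with `n` quartic vertices and `2N` external legs.

* `color v = c` says that the vertex `v` is the bubble `b_c`: in it the white and black nodes of
  the same half are joined by the five strands of colours other than `c`, and the strand of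
  colour `c` joins the white node of each half to the black node of the other half.
* `wick` contracts the black node of `d` with the white node of `wick d`; this arc is called `d`.
  The cycles of `wick` are the disks of the intermediate field representation, and the vertices
  are its wavy edges: `v` joins the disks of `(v, false)` and `(v, true)` and has colour `color v`.
* The arc `cilium j` is cut, and its two ends are the external legs number `j` (one exit at the
  black node of `cilium j`, one entrance at the white node of `wick (cilium j)`). All the other
  arcs are the internal lines.
* A disk bears at most one cilium, so that the strands entering at the leg `j` also exit at the
  leg `j`, with the same momentum. (The other contractions only permute the labels of the exits.)
-/
@[ext]
structure FeynmanGraph (n N : ℕ) : Type where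
  color : Fin n → Fin 6
  wick : Equiv.Perm (Half n)
  cilium : Fin N → Half n
  eq_of_sameCycle : ∀ i j, wick.SameCycle (cilium i) (cilium j) → i = j

instance (n N : ℕ) : Finite (FeynmanGraph n N) :=
  Finite.of_injective
    (fun G => (G.color, G.wick, G.cilium) :
      FeynmanGraph n N → (Fin n → Fin 6) × Equiv.Perm (Half n) × (Fin N → Half n))
    (by
      intro G H h
      simp only [Prod.mk.injEq] at h
      exact FeynmanGraph.ext h.1 h.2.1 h.2.2)

instance (n N : ℕ) : Fintype (FeynmanGraph n N) := Fintype.ofFinite _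

namespace FeynmanGraph

variable {n N : ℕ} (G : FeynmanGraph n N)

/-- The strand of colour `c` at the white node of `d` leads to the black node of `partner c d`. -/
def partner (c : Fin 6) : Equiv.Perm (Half n) :=
  Function.Involutive.toPerm
    (fun d => if G.color d.1 = c then (d.1, !d.2) else d)
    (by
      intro d
      by_cases h : G.color d.1 = c <;> simp [h])

/-- The internal lines: the arcs that are not cut. -/
abbrev Line : Type := {d : Half n // d ∉ Set.range G.cilium}

instance : Fintype G.Line := Fintype.ofFinite _

/-! ### Amplitudes -/

/-- The amputated amplitude. A momentum `K d` is attributed to every arc, equal to the external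
momentum `p j` on the cut arc number `j`; at every vertex the strands impose the equality of the
momenta that they join; every internal line bears a propagator. Only finitely many `K` give a
non-zero term. -/
def amplitude (m M : ℝ) (ρ : ℕ) (p : Fin N → GaugeMomentum) : ℝ :=
  open Classical in
  ∑' K : Half n → Momentum,
    if (∀ j, K (G.cilium j) = (p j).1) ∧
        (∀ d c, K (G.wick.symm d) c = K (G.partner c d) c) then
      ∏ l : G.Line, propagator m M ρ (K l.1)
    else 0

/-! ### One-particle irreducibility -/

/-- The graph on the vertices whose edges are the arcs in `S`. -/
def vertexGraph (S : Set (Half n)) : SimpleGraph (Fin n) :=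
  SimpleGraph.fromRel fun v w => ∃ d ∈ S, d.1 = v ∧ (G.wick d).1 = w

/-- The graph is connected and remains so if any one internal line is removed. -/
def IsOnePI : Prop :=
  (G.vertexGraph (Set.range G.cilium)ᶜ).Connected ∧
    ∀ l ∉ Set.range G.cilium, (G.vertexGraph ((Set.range G.cilium)ᶜ \ {l})).Connected

/-! ### Divergence degree -/

/-- The faces of colour `c`, before the external arcs are cut, are the cycles of this
permutation of the arcs. -/
def facePerm (c : Fin 6) : Equiv.Perm (Half n) := G.partner c * G.wick

/-- The faces of colour `c` before the external arcs are cut. -/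
abbrev Face (c : Fin 6) : Type := Quotient (Equiv.Perm.SameCycle.setoid (G.facePerm c))

/-- The face of colour `c` through the arc `d`. -/
def faceOf (c : Fin 6) (d : Half n) : G.Face c := Quotient.mk _ d

/-- The internal (closed) faces: those that contain no cut arc. -/
abbrev InternalFace : Type :=
  {f : Σ c, G.Face c // ∀ j, G.faceOf f.1 (G.cilium j) ≠ f.2}

instance : Fintype G.InternalFace := Fintype.ofFinite _

/-- The incidence matrix of internal lines and internal faces. As the lines join black to white
nodes, all the signs are `+1`. -/
def incidence : Matrix G.Line G.InternalFace ℚ :=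
  open Classical in
  fun l f => if G.faceOf f.1.1 l.1 = f.1.2 then 1 else 0

/-- The divergence degree `ω = -2L + F - R`. -/
def divergenceDegree : ℤ :=
  -2 * (Fintype.card G.Line : ℤ) + (Fintype.card G.InternalFace : ℤ) - (G.incidence.rank : ℤ)

/-! ### Melonic graphs -/

/-- The edges of the 7-regular bipartite coloured graph associated with `G` (with the external
legs number `j` joined together again): the edge of colour `i` at the white node of `d` leads to
the black node of `coloredEdge i d`. The colour `0` is that of the propagators, and `c.succ` is
the strand colour `c`. -/
def coloredEdge (i : Fin 7) : Equiv.Perm (Half n) :=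
  Fin.cases G.wick.symm G.partner i

/-- The number of faces of colours `i`, `j` of the coloured graph. -/
def numBicolored (i j : Fin 7) : ℕ :=
  Nat.card (Quotient (Equiv.Perm.SameCycle.setoid ((G.coloredEdge i)⁻¹ * G.coloredEdge j)))

/-- The genus of the jacket of the 7-cycle `ξ`, from Euler's formula `V - E + F = 2 - 2g`.
There are `2 * (2n)` nodes, `7 * (2n)` edges, and the faces are those of colours `i`, `ξ i`. -/
def jacketGenus (ξ : Equiv.Perm (Fin 7)) : ℚ :=
  1 - ((2 * (2 * n) : ℚ) - 7 * (2 * n) + ∑ i, (G.numBicolored i (ξ i) : ℚ)) / 2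

/-- The degree of the associated (closed) coloured graph: the sum of the genera of all jackets. A jacket is a 7-cycle up to orientation,
whence the factor `1/2`. -/
def degree : ℚ :=
  open Classical in
  (∑ ξ : Equiv.Perm (Fin 7) with ξ.IsCycle ∧ ξ.support = Finset.univ, G.jacketGenus ξ) / 2

/-- Melonic graphs are those of degree zero. -/
def IsMelonic : Prop := G.degree = 0

/-- In the intermediate field representation the two ciliated disks of a four-point graph are
joined by a path of wavy edges that all have the colour `c`. -/
def IsMono (G : FeynmanGraph n 2) (c : Fin 6) : Prop :=
  Relation.EqvGen
    (fun d d' => G.wick.SameCycle d d' ∨ (G.color d.1 = c ∧ d' = (d.1, !d.2)))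
    (G.cilium 0) (G.cilium 1)

end FeynmanGraph

/-! ### Vertex functions -/

/-- A class of graphs with `2N` external legs. -/
abbrev GraphClass (N : ℕ) : Type := ∀ n, Set (FeynmanGraph n N)

/-- A function of the cutoff `ρ` and of `N` external momenta, with values in the formal power
series in the coupling constant. -/
abbrev FormalFunction (N : ℕ) : Type := ℕ → (Fin N → GaugeMomentum) → PowerSeries ℝ

/-- The sum of the graphs of the class `S`: the coefficient of `lam ^ n` is `(-1) ^ n / n!` times
the sum of the amplitudes of the labelled graphs of order `n`. -/
def feynmanSum (m M : ℝ) {N : ℕ} (S : GraphClass N) : FormalFunction N := fun ρ p =>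
  open Classical in
  PowerSeries.mk fun n =>
    (-1) ^ n / (n.factorial : ℝ) *
      ∑ G : FeynmanGraph n N, if G ∈ S n then G.amplitude m M ρ p else 0

/-- The one-particle irreducible graphs. -/
def onePI (N : ℕ) : GraphClass N := fun _ => {G | G.IsOnePI}

/-- The one-particle irreducible melonic graphs. -/
def onePIMelonic (N : ℕ) : GraphClass N := fun _ => {G | G.IsOnePI ∧ G.IsMelonic}

/-- The one-particle irreducible four-point graphs that are monocolour of colour `c`. -/
def onePIMono (c : Fin 6) : GraphClass 2 := fun _ => {G | G.IsOnePI ∧ G.IsMono c}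

/-- The melonic one-particle irreducible four-point graphs that are monocolour of colour `c`. -/
def onePIMelonicMono (c : Fin 6) : GraphClass 2 :=
  fun _ => {G | G.IsOnePI ∧ G.IsMelonic ∧ G.IsMono c}

/-- The vertex function `Γ_{2N}`. -/
def vertexFunction (m M : ℝ) (N : ℕ) : FormalFunction N := feynmanSum m M (onePI N)

/-- `Γ_2^{melo}`. -/
def vertexTwoMelo (m M : ℝ) : FormalFunction 1 := feynmanSum m M (onePIMelonic 1)

/-- The part `Γ_{4,mono}` of `Γ_4` of colour `c`. -/
def vertexFourMono (m M : ℝ) (c : Fin 6) : FormalFunction 2 := feynmanSum m M (onePIMono c)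

/-- `Γ_{4,mono}^{melo}` for the colour `c`. -/
def vertexFourMonoMelo (m M : ℝ) (c : Fin 6) : FormalFunction 2 :=
  feynmanSum m M (onePIMelonicMono c)

/-- `Γ` is superficially convergent: it is the sum of the graphs of the class `S`, all of which
have a negative divergence degree. -/
structure IsSuperficiallyConvergent (m M : ℝ) {N : ℕ} (S : GraphClass N)
    (Γ : FormalFunction N) : Prop where
  expansion : Γ = feynmanSum m M S
  degree_neg : ∀ n, ∀ G ∈ S n, G.divergenceDegree < 0

/-- The coefficient of order `k` of a cutoff-dependent formal power series is ultraviolet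
divergent: it tends to infinity in absolute value when the cutoff is removed. -/
def DivergesAtOrder (F : ℕ → PowerSeries ℝ) (k : ℕ) : Prop :=
  Tendsto (fun ρ => |PowerSeries.coeff k (F ρ)|) atTop atTop

end

end TGFT

/-!
Gauge invariance makes the momentum constant along each disk, so a graph is a map whose vertices
are its `V` disks and whose edges are its `n` wavy edges. The edges of each colour form a map of
non-negative genus, that is `faces + V ≤ 2 * components + edges`, and since the numbers of
components are submodular in the set of edges, the degree vanishes exactly when the whole map is a
tree.

The divergence degree is `-2L` plus the dimension of the space of fields of gauge-invariant momenta
on the disks that vanish on the ciliated disks and whose `c`-th component is equal on any two disks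
joined by an edge of colour `c`. Exploring the graph from the ciliated disks, each new disk meets at
least one constraint and so brings at most four dimensions, whence `ω ≤ 4 (V - n) - 2N`. This is
negative if the map is not a tree or if `N ≥ 3`; for `N = 2` it is strict when the two ciliated
disks are not joined by a path of a single colour, since the path between them then has a disk
that meets two constraints.

In a melonic one-particle irreducible graph the ciliated disks are leaves, so the amplitude depends
only on the strand of the colour of their edge. All amplitudes are nonnegative, so it is enough for
the divergence to exhibit one divergent chain of disks at each order; its amplitude contains the sum
of `1 / (p ^ 2 + m ^ 2) ^ 2` over a four-dimensional lattice, which diverges logarithmically.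
-/

namespace TGFT

open Equiv Filter Module

noncomputable section

/-! ### Cycles of permutations -/

section LinearAlgebra

variable {𝕜 V V₂ : Type*} [Field 𝕜] [AddCommGroup V] [Module 𝕜 V] [FiniteDimensional 𝕜 V]
  [AddCommGroup V₂] [Module 𝕜 V₂] [FiniteDimensional 𝕜 V₂]

theorem finrank_le_finrank_add_of_inf_ker_le {W W' : Submodule 𝕜 V} {R : Submodule 𝕜 V₂}
    (ℓ : V →ₗ[𝕜] V₂) (hmap : W ≤ R.comap ℓ) (hker : W ⊓ LinearMap.ker ℓ ≤ W') :
    finrank 𝕜 W ≤ finrank 𝕜 W' + finrank 𝕜 R := by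
  have hrank := LinearMap.finrank_range_add_finrank_ker (ℓ.restrict hmap)
  have hrange := Submodule.finrank_le (LinearMap.range (ℓ.restrict hmap))
  have hkernel : finrank 𝕜 (LinearMap.ker (ℓ.restrict hmap)) ≤ finrank 𝕜 W' := by
    rw [← Submodule.finrank_map_subtype_eq W]
    refine Submodule.finrank_mono ?_
    rintro _ ⟨w, hw, rfl⟩
    exact hker ⟨w.2, by simpa using congrArg Subtype.val (LinearMap.mem_ker.1 hw)⟩
  omega

theorem finrank_le_finrank_add_one_of_apply_eq {α : Type*} [Finite α]
    {W W' : Submodule 𝕜 (α → 𝕜)} (x y : α) (h : ∀ φ ∈ W, φ x = φ y → φ ∈ W') :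
    finrank 𝕜 W ≤ finrank 𝕜 W' + 1 := by
  have hle := finrank_le_finrank_add_of_inf_ker_le (W := W) (W' := W') (R := ⊤)
    (LinearMap.proj (R := 𝕜) (φ := fun _ : α => 𝕜) x - LinearMap.proj y) (fun _ _ => trivial)
    (fun φ hφ => h φ hφ.1 (by simpa [sub_eq_zero] using hφ.2))
  rwa [finrank_top, finrank_self] at hle

end LinearAlgebra

section Cycles

variable {α β : Type*}

/-- The number of cycles of a permutation, including its fixed points. -/
def numCycles (σ : Perm α) : ℕ := Nat.card (Quotient (Perm.SameCycle.setoid σ))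

/-- The rational functions that are constant along the cycles of a permutation. They turn the
counting of cycles into linear algebra. -/
def invariants (σ : Perm α) : Submodule ℚ (α → ℚ) :=
  LinearMap.eqLocus (LinearMap.funLeft ℚ ℚ σ) LinearMap.id

theorem mem_invariants {σ : Perm α} {φ : α → ℚ} : φ ∈ invariants σ ↔ ∀ a, φ (σ a) = φ a :=
  funext_iff

theorem apply_eq_of_sameCycle {σ : Perm α} {φ : α → β} (h : ∀ a, φ (σ a) = φ a) {a b : α}
    (hab : σ.SameCycle a b) : φ a = φ b := by
  have hinv (a : α) : φ (σ⁻¹ a) = φ a := by simpa using (h (σ⁻¹ a)).symm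
  obtain ⟨i, rfl⟩ := hab
  induction i with
  | zero => rfl
  | succ i ih => rw [add_comm, zpow_one_add, Perm.mul_apply, h, ih]
  | pred i ih =>
    rw [sub_eq_neg_add, zpow_add, zpow_neg_one, Perm.mul_apply, hinv, ih]

theorem finrank_invariants [Finite α] (σ : Perm α) : finrank ℚ (invariants σ) = numCycles σ := by
  have hinj := LinearMap.funLeft_injective_of_surjective ℚ ℚ
    (Quotient.mk (Perm.SameCycle.setoid σ)) Quotient.mk_surjective
  have hrange : LinearMap.range (LinearMap.funLeft ℚ ℚ (Quotient.mk (Perm.SameCycle.setoid σ))) =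
      invariants σ := by
    ext φ
    rw [mem_invariants]
    constructor
    · rintro ⟨ψ, rfl⟩ a
      exact congrArg ψ (Quotient.sound (Perm.sameCycle_apply_left.2 (Perm.SameCycle.refl σ a)))
    · exact fun hφ => ⟨Quotient.lift φ fun a b => apply_eq_of_sameCycle hφ, rfl⟩
  have := Fintype.ofFinite (Quotient (Perm.SameCycle.setoid σ))
  rw [← hrange, LinearMap.finrank_range_of_inj hinj, finrank_fintype_fun_eq_card,
    ← Nat.card_eq_fintype_card, numCycles]

theorem card_le_numCycles [Finite α] {σ : Perm α} {φ : α → β} (hφ : ∀ a, φ (σ a) = φ a)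
    (hsurj : φ.Surjective) : Nat.card β ≤ numCycles σ :=
  Nat.card_le_card_of_surjective (Quotient.lift φ fun _ _ => apply_eq_of_sameCycle hφ)
    (Quotient.lift_surjective _ _ hsurj)

theorem numCycles_one : numCycles (1 : Perm α) = Nat.card α :=
  (Nat.card_congr (Equiv.ofBijective (Quotient.mk (Perm.SameCycle.setoid (1 : Perm α)))
    ⟨fun _ _ h => Perm.sameCycle_one.1 (Quotient.exact h), Quotient.mk_surjective⟩)).symm

theorem numCycles_inv (σ : Perm α) : numCycles σ⁻¹ = numCycles σ :=
  Nat.card_congr (Quotient.congrRight fun _ _ => Perm.sameCycle_inv)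

variable [DecidableEq α]

theorem mul_swap_mem_invariants {σ : Perm α} {x y : α} {φ : α → ℚ} (hφ : φ ∈ invariants σ)
    (hxy : φ x = φ y) : φ ∈ invariants (σ * swap x y) := by
  rw [mem_invariants] at hφ ⊢
  intro a
  rw [Perm.mul_apply, hφ, swap_apply_def]
  split_ifs with hx hy
  exacts [hx ▸ hxy.symm, hy ▸ hxy, rfl]

variable [Finite α]

theorem numCycles_le_mul_swap_add_one (σ : Perm α) (x y : α) :
    numCycles σ ≤ numCycles (σ * swap x y) + 1 := by
  rw [← finrank_invariants, ← finrank_invariants]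
  exact finrank_le_finrank_add_one_of_apply_eq x y fun _ => mul_swap_mem_invariants

theorem numCycles_mul_swap_le (σ : Perm α) (x y : α) :
    numCycles (σ * swap x y) ≤ numCycles σ + 1 := by
  simpa only [mul_swap_mul_self] using numCycles_le_mul_swap_add_one (σ * swap x y) x y

theorem apply_eq_of_mem_invariants_mul_swap {σ : Perm α} {x y : α} (hxy : ¬ σ.SameCycle x y)
    {φ : α → ℚ} (hφ : φ ∈ invariants (σ * swap x y)) : φ x = φ y := by
  classical
  have := Fintype.ofFinite α
  let cycle : Finset α := {a | σ.SameCycle a y}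
  have hy : y ∈ cycle := by simp [cycle, Perm.SameCycle.refl]
  have hsum : ∑ a ∈ cycle, φ (σ a) = ∑ a ∈ cycle, φ a :=
    Finset.sum_equiv σ (fun a => by simp [cycle]) fun _ _ => rfl
  have hrest : ∑ a ∈ cycle.erase y, φ (σ a) = ∑ a ∈ cycle.erase y, φ a := by
    refine Finset.sum_congr rfl fun a ha => ?_
    obtain ⟨hay, ha⟩ := Finset.mem_erase.1 ha
    have hax : a ≠ x := by
      rintro rfl
      exact hxy (Finset.mem_filter.1 ha).2
    simpa only [Perm.mul_apply, swap_apply_of_ne_of_ne hax hay] using mem_invariants.1 hφ a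
  rw [← Finset.add_sum_erase _ _ hy, ← Finset.add_sum_erase _ _ hy, hrest] at hsum
  have hx := mem_invariants.1 hφ x
  rw [Perm.mul_apply, swap_apply_left] at hx
  exact hx.symm.trans (add_right_cancel hsum)

theorem numCycles_mul_swap_add_one {σ : Perm α} {x y : α} (hxy : ¬ σ.SameCycle x y) :
    numCycles (σ * swap x y) + 1 = numCycles σ := by
  classical
  refine le_antisymm ?_ (numCycles_le_mul_swap_add_one σ x y)
  have hle : invariants (σ * swap x y) ≤ invariants σ := fun φ hφ => by
    simpa only [mul_swap_mul_self] using
      mul_swap_mem_invariants hφ (apply_eq_of_mem_invariants_mul_swap hxy hφ)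
  let ψ : α → ℚ := fun a => if σ.SameCycle a x then 1 else 0
  have hψ : ψ ∈ invariants σ := mem_invariants.2 fun a => by simp [ψ]
  have hψxy : ψ x ≠ ψ y := by simp [ψ, Perm.SameCycle.refl, Perm.sameCycle_comm (x := y), hxy]
  have hψ' : ψ ∉ invariants (σ * swap x y) := fun h =>
    hψxy (apply_eq_of_mem_invariants_mul_swap hxy h)
  rw [← finrank_invariants, ← finrank_invariants, Nat.succ_le_iff]
  exact Submodule.finrank_lt_finrank_of_lt (lt_of_le_of_ne hle fun h => hψ' (h ▸ hψ))

end Cycles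

/-! ### Maps on the strands -/

section Maps

variable {V : Type*} [DecidableEq V]

/-- The exchange of the two halves of each of the vertices in `S`. -/
def exchange (S : Finset V) : Perm (V × Bool) :=
  Function.Involutive.toPerm (fun d => if d.1 ∈ S then (d.1, !d.2) else d) fun d => by
    by_cases h : d.1 ∈ S <;> simp [h]

theorem exchange_apply (S : Finset V) (d : V × Bool) :
    exchange S d = if d.1 ∈ S then (d.1, !d.2) else d := rfl

theorem exchange_empty : exchange (∅ : Finset V) = 1 := rfl

theorem exchange_inv (S : Finset V) : (exchange S)⁻¹ = exchange S := rfl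

theorem exchange_mul_exchange {S T : Finset V} (h : Disjoint S T) :
    exchange S * exchange T = exchange (S ∪ T) := by
  ext1 ⟨v, b⟩
  by_cases hT : v ∈ T
  · simp [exchange_apply, hT, Finset.disjoint_right.1 h hT]
  · simp [exchange_apply, hT]

theorem exchange_singleton (v : V) : exchange {v} = swap (v, false) (v, true) := by
  ext1 ⟨u, b⟩
  rcases eq_or_ne u v with rfl | h
  · cases b <;> simp [exchange_apply]
  · rw [swap_apply_of_ne_of_ne] <;> simp [exchange_apply, h]

theorem exchange_insert {S : Finset V} {v : V} (hv : v ∉ S) :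
    exchange (insert v S) = exchange S * swap (v, false) (v, true) := by
  rw [← exchange_singleton, exchange_mul_exchange (by simpa using hv), Finset.union_comm,
    Finset.insert_eq]

theorem mem_invariants_exchange {S : Finset V} {φ : V × Bool → ℚ} :
    φ ∈ invariants (exchange S) ↔ ∀ v ∈ S, φ (v, false) = φ (v, true) := by
  rw [mem_invariants]
  refine ⟨fun h v hv => by simpa [exchange_apply, hv] using h (v, true), fun h d => ?_⟩
  rw [exchange_apply]
  split_ifs with hd
  · obtain ⟨v, _ | _⟩ := d
    exacts [(h v hd).symm, h v hd]
  · rfl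

theorem numCycles_exchange_add_card [Finite V] (S : Finset V) :
    numCycles (exchange S) + S.card = 2 * Nat.card V := by
  induction S using Finset.induction_on with
  | empty => simp [exchange_empty, numCycles_one, mul_comm]
  | insert v S hv ih =>
    have hfixed : Function.IsFixedPt (exchange S) (v, false) := by
      simp [Function.IsFixedPt, exchange_apply, hv]
    have hcycle : ¬ (exchange S).SameCycle (v, false) (v, true) := fun h => by
      simpa using h.eq_of_left hfixed
    rw [exchange_insert hv, Finset.card_insert_of_notMem hv, ← ih,
      ← numCycles_mul_swap_add_one hcycle]
    ring

/-- A permutation `w` of the half-vertices and a set `S` of vertices determine a map: its disks are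
the cycles of `w`, and each vertex in `S` is an edge between the disks of its two halves. This is
the space of the functions that are constant on its connected components, whose dimension is their
number. -/
def componentFunctions (w : Perm (V × Bool)) (S : Finset V) : Submodule ℚ (V × Bool → ℚ) :=
  invariants w ⊓ invariants (exchange S)

theorem componentFunctions_empty (w : Perm (V × Bool)) :
    componentFunctions w ∅ = invariants w :=
  inf_eq_left.2 fun _ _ => mem_invariants_exchange.2 (by simp)

theorem componentFunctions_union (w : Perm (V × Bool)) (S T : Finset V) :
    componentFunctions w (S ∪ T) = componentFunctions w S ⊓ componentFunctions w T := by
  have hunion : invariants (exchange (S ∪ T)) =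
      invariants (exchange S) ⊓ invariants (exchange T) := by
    ext φ
    simp only [Submodule.mem_inf, mem_invariants_exchange, Finset.mem_union, or_imp, forall_and]
  rw [componentFunctions, hunion, inf_inf_distrib_left]
  rfl

theorem componentFunctions_le_invariants_mul (w : Perm (V × Bool)) (S : Finset V) :
    componentFunctions w S ≤ invariants (w * exchange S) := fun _ hφ =>
  mem_invariants.2 fun d => (mem_invariants.1 hφ.1 _).trans (mem_invariants.1 hφ.2 d)

theorem mem_componentFunctions_insert {w : Perm (V × Bool)} {S : Finset V} {v : V}
    {φ : V × Bool → ℚ} (hφ : φ ∈ componentFunctions w S) (hv : φ (v, false) = φ (v, true)) :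
    φ ∈ componentFunctions w (insert v S) :=
  ⟨hφ.1, mem_invariants_exchange.2
    (Finset.forall_mem_insert v S _ |>.2 ⟨hv, mem_invariants_exchange.1 hφ.2⟩)⟩

variable [Finite V]

theorem finrank_componentFunctions_le_insert (w : Perm (V × Bool)) (S : Finset V) (v : V) :
    finrank ℚ (componentFunctions w S) ≤ finrank ℚ (componentFunctions w (insert v S)) + 1 :=
  finrank_le_finrank_add_one_of_apply_eq (v, false) (v, true)
    fun _ => mem_componentFunctions_insert

theorem numCycles_le_finrank_componentFunctions_add_card (w : Perm (V × Bool)) (S : Finset V) :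
    numCycles w ≤ finrank ℚ (componentFunctions w S) + S.card := by
  induction S using Finset.induction_on with
  | empty => rw [componentFunctions_empty, finrank_invariants, Finset.card_empty, add_zero]
  | insert v S hv ih =>
    rw [Finset.card_insert_of_notMem hv]
    have := finrank_componentFunctions_le_insert w S v
    omega

theorem numCycles_le_mul_exchange_add_card (w : Perm (V × Bool)) (S : Finset V) :
    numCycles w ≤ numCycles (w * exchange S) + S.card := by
  induction S using Finset.induction_on with
  | empty => simp [exchange_empty]
  | insert v S hv ih =>
    rw [exchange_insert hv, Finset.card_insert_of_notMem hv, ← mul_assoc]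
    have := numCycles_le_mul_swap_add_one (w * exchange S) (v, false) (v, true)
    omega

/-- By Euler's formula this is the non-negativity of the genus of the map: its faces are the cycles
of `w * exchange S`. -/
theorem numCycles_mul_exchange_add_le (w : Perm (V × Bool)) (S : Finset V) :
    numCycles (w * exchange S) + numCycles w ≤
      2 * finrank ℚ (componentFunctions w S) + S.card := by
  induction S using Finset.induction_on with
  | empty =>
    rw [exchange_empty, mul_one, componentFunctions_empty, finrank_invariants, Finset.card_empty]
    omega
  | insert v S hv ih =>
    rw [exchange_insert hv, Finset.card_insert_of_notMem hv, ← mul_assoc]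
    by_cases hcycle : (w * exchange S).SameCycle (v, false) (v, true)
    · have hfunctions : finrank ℚ (componentFunctions w S) ≤
          finrank ℚ (componentFunctions w (insert v S)) :=
        Submodule.finrank_mono fun φ hφ => mem_componentFunctions_insert hφ <|
          apply_eq_of_sameCycle (mem_invariants.1 (componentFunctions_le_invariants_mul w S hφ))
            hcycle
      have := numCycles_mul_swap_le (w * exchange S) (v, false) (v, true)
      omega
    · have := numCycles_mul_swap_add_one hcycle
      have := finrank_componentFunctions_le_insert w S v
      omega

theorem sum_finrank_componentFunctions_add_le (w : Perm (V × Bool)) {ι : Type*}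
    (T : Finset ι) (S : ι → Finset V) :
    ∑ c ∈ T, finrank ℚ (componentFunctions w (S c)) + numCycles w ≤
      T.card * numCycles w + finrank ℚ (componentFunctions w (T.biUnion S)) := by
  classical
  induction T using Finset.induction_on with
  | empty =>
    rw [Finset.biUnion_empty, componentFunctions_empty, finrank_invariants, Finset.sum_empty,
      Finset.card_empty, zero_mul]
  | insert c T hc ih =>
    rw [Finset.sum_insert hc, Finset.card_insert_of_notMem hc, Finset.biUnion_insert,
      componentFunctions_union, add_mul, one_mul]
    have hsubmodular := Submodule.finrank_sup_add_finrank_inf_eq (componentFunctions w (S c))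
      (componentFunctions w (T.biUnion S))
    have hsup : finrank ℚ ↥(componentFunctions w (S c) ⊔ componentFunctions w (T.biUnion S)) ≤
        numCycles w := by
      rw [← finrank_invariants]
      exact Submodule.finrank_mono (sup_le inf_le_left inf_le_left)
    omega

end Maps

section ConnectedMaps

variable {V : Type*} [DecidableEq V] [Fintype V]

/-- The map whose edges are all the vertices is connected. -/
def IsConnectedMap (w : Perm (V × Bool)) : Prop :=
  ∀ φ ∈ componentFunctions w Finset.univ, ∀ d d', φ d = φ d'

theorem IsConnectedMap.finrank_le_one {w : Perm (V × Bool)} (h : IsConnectedMap w) :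
    finrank ℚ (componentFunctions w Finset.univ) ≤ 1 := by
  have hspan : componentFunctions w Finset.univ ≤ Submodule.span ℚ {fun _ => 1} := fun φ hφ => by
    rcases isEmpty_or_nonempty V with hV | ⟨⟨v⟩⟩
    · exact (Subsingleton.elim 0 φ) ▸ zero_mem _
    · exact Submodule.mem_span_singleton.2
        ⟨φ (v, true), funext fun d => by simp [h φ hφ d (v, true)]⟩
  simpa using (Submodule.finrank_mono hspan).trans (finrank_span_le_card _)

theorem IsConnectedMap.numCycles_le {w : Perm (V × Bool)} (h : IsConnectedMap w) :
    numCycles w ≤ Fintype.card V + 1 := by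
  have := numCycles_le_finrank_componentFunctions_add_card w Finset.univ
  have := h.finrank_le_one
  rw [← Finset.card_univ]
  omega

theorem IsConnectedMap.sum_numCycles_mul_exchange_add_card_eq_iff {w : Perm (V × Bool)}
    (h : IsConnectedMap w) {ι : Type*} [Fintype ι] [DecidableEq ι] (hι : 3 ≤ Fintype.card ι)
    (color : V → ι) :
    ∑ c, numCycles (w * exchange {v | color v = c}) + Fintype.card V =
      Fintype.card ι * (Fintype.card V + 1) ↔ numCycles w = Fintype.card V + 1 := by
  let S (c : ι) : Finset V := {v | color v = c}
  have hcard : ∑ c, (S c).card = Fintype.card V :=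
    (Finset.card_eq_sum_card_fiberwise fun v _ => Finset.mem_coe.2 (Finset.mem_univ (color v))).symm
  have hgenus : ∑ c, numCycles (w * exchange (S c)) + Fintype.card ι * numCycles w ≤
      2 * ∑ c, finrank ℚ (componentFunctions w (S c)) + Fintype.card V := by
    have := Finset.sum_le_sum fun c (_ : c ∈ Finset.univ) => numCycles_mul_exchange_add_le w (S c)
    rwa [Finset.sum_add_distrib, Finset.sum_add_distrib, hcard, ← Finset.mul_sum,
      Finset.sum_const, Finset.card_univ, smul_eq_mul] at this
  have hcomponents : ∑ c, finrank ℚ (componentFunctions w (S c)) + numCycles w ≤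
      Fintype.card ι * numCycles w + 1 := by
    have hunion : Finset.univ.biUnion S = Finset.univ := by ext v; simp [S]
    have := sum_finrank_componentFunctions_add_le w Finset.univ S
    rw [hunion, Finset.card_univ] at this
    exact this.trans (Nat.add_le_add_left h.finrank_le_one _)
  have hfaces : Fintype.card ι * numCycles w ≤
      ∑ c, numCycles (w * exchange (S c)) + Fintype.card V := by
    have := Finset.sum_le_sum fun c (_ : c ∈ Finset.univ) =>
      numCycles_le_mul_exchange_add_card w (S c)
    rwa [Finset.sum_add_distrib, hcard, Finset.sum_const, Finset.card_univ, smul_eq_mul] at this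
  have hvertices := h.numCycles_le
  obtain ⟨D, hD⟩ := Nat.exists_eq_add_of_le hι
  change ∑ c, numCycles (w * exchange (S c)) + Fintype.card V = _ ↔ _
  refine ⟨fun hF => by nlinarith, fun hw => ?_⟩
  rw [hw] at hgenus hcomponents hfaces
  exact le_antisymm (by linarith) hfaces

end ConnectedMaps

/-! ### Melonic graphs -/

section Jackets

variable {ι : Type*} [Fintype ι] [DecidableEq ι]

/-- The cyclic permutations of all the colours, that is the jackets with an orientation. -/
def fullCycles (ι : Type*) [Fintype ι] [DecidableEq ι] : Finset (Perm ι) :=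
  open Classical in {ξ | ξ.IsCycle ∧ ξ.support = Finset.univ}

theorem mem_fullCycles {ξ : Perm ι} :
    ξ ∈ fullCycles ι ↔ ξ.IsCycle ∧ ξ.support = Finset.univ := by
  simp [fullCycles]

theorem conj_mem_fullCycles {ξ : Perm ι} (τ : Perm ι) (hξ : ξ ∈ fullCycles ι) :
    τ * ξ * τ⁻¹ ∈ fullCycles ι := by
  rw [mem_fullCycles] at hξ ⊢
  exact ⟨hξ.1.conj, by simp [hξ.2]⟩

theorem apply_ne_of_mem_fullCycles {ξ : Perm ι} (hξ : ξ ∈ fullCycles ι) (i : ι) : ξ i ≠ i :=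
  Perm.mem_support.1 ((mem_fullCycles.1 hξ).2 ▸ Finset.mem_univ i)

theorem fullCycles_fin_nonempty (n : ℕ) : (fullCycles (Fin (n + 2))).Nonempty :=
  ⟨finRotate (n + 2), mem_fullCycles.2 ⟨isCycle_finRotate, support_finRotate⟩⟩

theorem card_fullCycles_apply_eq_le {i j j' : ι} (hj : j ≠ i) (hj' : j' ≠ i) :
    {ξ ∈ fullCycles ι | ξ i = j}.card ≤ {ξ ∈ fullCycles ι | ξ i = j'}.card := by
  refine Finset.card_le_card_of_injOn (MulAut.conj (swap j j')) (fun ξ hξ => ?_)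
    (MulEquiv.injective _).injOn
  simp only [Finset.coe_filter, Set.mem_ofPred_eq] at hξ ⊢
  refine ⟨conj_mem_fullCycles _ hξ.1, ?_⟩
  simp [MulAut.conj_apply, swap_apply_of_ne_of_ne hj.symm hj'.symm, hξ.2]

theorem card_sub_one_mul_card_fullCycles_apply_eq {i j : ι} (hij : j ≠ i) :
    (Fintype.card ι - 1) * {ξ ∈ fullCycles ι | ξ i = j}.card = (fullCycles ι).card := by
  have hmaps : ∀ ξ ∈ fullCycles ι, ξ i ∈ Finset.univ.erase i := fun ξ hξ =>
    Finset.mem_erase.2 ⟨apply_ne_of_mem_fullCycles hξ i, Finset.mem_univ _⟩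
  rw [Finset.card_eq_sum_card_fiberwise hmaps, Finset.sum_congr rfl fun j' hj' =>
    le_antisymm (card_fullCycles_apply_eq_le (Finset.ne_of_mem_erase hj') hij)
      (card_fullCycles_apply_eq_le hij (Finset.ne_of_mem_erase hj'))]
  simp

/-- Every ordered pair of distinct colours is consecutive in the same number of jackets. -/
theorem card_sub_one_mul_sum_fullCycles (F : ι → ι → ℚ) :
    (Fintype.card ι - 1 : ℕ) * ∑ ξ ∈ fullCycles ι, ∑ i, F i (ξ i) =
      (fullCycles ι).card * ∑ i, ∑ j with j ≠ i, F i j := by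
  rw [Finset.sum_comm, Finset.mul_sum, Finset.mul_sum]
  refine Finset.sum_congr rfl fun i _ => ?_
  rw [← Finset.sum_fiberwise_of_maps_to (t := {j | j ≠ i}) (g := fun ξ : Perm ι => ξ i)
    fun ξ hξ => by simpa using apply_ne_of_mem_fullCycles hξ i, Finset.mul_sum, Finset.mul_sum]
  refine Finset.sum_congr rfl fun j hj => ?_
  rw [Finset.sum_congr rfl fun ξ hξ => by rw [(Finset.mem_filter.1 hξ).2], Finset.sum_const,
    nsmul_eq_mul, ← mul_assoc, ← Nat.cast_mul,
    card_sub_one_mul_card_fullCycles_apply_eq (Finset.mem_filter.1 hj).2]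

end Jackets

namespace FeynmanGraph

variable {n N : ℕ} (G : FeynmanGraph n N)

/-- The vertices of colour `c`. -/
def colored (c : Fin 6) : Finset (Fin n) := {v | G.color v = c}

theorem partner_apply (c : Fin 6) (d : Half n) :
    G.partner c d = if G.color d.1 = c then (d.1, !d.2) else d := rfl

theorem partner_eq_exchange (c : Fin 6) : G.partner c = exchange (G.colored c) := by
  ext1 d
  simp [partner_apply, exchange_apply, colored]

theorem sum_card_colored : ∑ c, (G.colored c).card = n := by
  have hcard := Finset.card_eq_sum_card_fiberwise (f := G.color) (s := Finset.univ)
    (t := Finset.univ) fun v _ => Finset.mem_coe.2 (Finset.mem_univ _)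
  rw [Finset.card_univ, Fintype.card_fin] at hcard
  exact hcard.symm

theorem disjoint_colored {c c' : Fin 6} (h : c ≠ c') :
    Disjoint (G.colored c) (G.colored c') :=
  Finset.disjoint_filter.2 fun _ _ hv hv' => h (hv.symm.trans hv')

theorem numBicolored_eq (i j : Fin 7) :
    G.numBicolored i j = numCycles ((G.coloredEdge i)⁻¹ * G.coloredEdge j) := rfl

theorem numBicolored_comm (i j : Fin 7) : G.numBicolored i j = G.numBicolored j i := by
  rw [numBicolored_eq, numBicolored_eq, ← numCycles_inv, mul_inv_rev, inv_inv]

theorem numBicolored_zero_succ (c : Fin 6) :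
    G.numBicolored 0 c.succ = numCycles (G.wick * G.partner c) := rfl

theorem numBicolored_succ_succ {c c' : Fin 6} (h : c ≠ c') :
    G.numBicolored c.succ c'.succ + ((G.colored c).card + (G.colored c').card) = 2 * n := by
  have hpartner : G.numBicolored c.succ c'.succ = numCycles ((G.partner c)⁻¹ * G.partner c') := rfl
  rw [hpartner, partner_eq_exchange, partner_eq_exchange, exchange_inv,
    exchange_mul_exchange (G.disjoint_colored h),
    ← Finset.card_union_of_disjoint (G.disjoint_colored h), numCycles_exchange_add_card,
    Nat.card_fin]

theorem sum_numBicolored_succ (c : Fin 6) :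
    ∑ c' with c' ≠ c, (G.numBicolored c.succ c'.succ : ℚ) = 9 * n - 4 * (G.colored c).card := by
  have hterm (c' : Fin 6) (hc' : c' ∈ ({c' | c' ≠ c} : Finset (Fin 6))) :
      (G.numBicolored c.succ c'.succ : ℚ) = 2 * n - (G.colored c).card - (G.colored c').card := by
    have := G.numBicolored_succ_succ (Finset.mem_filter.1 hc').2.symm
    qify at this
    linarith
  have hsum : ∑ c', ((G.colored c').card : ℚ) = n := by exact_mod_cast G.sum_card_colored
  rw [Finset.sum_congr rfl hterm, Finset.filter_ne', Finset.sum_sub_distrib,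
    Finset.sum_erase_eq_sub (Finset.mem_univ c), Finset.sum_erase_eq_sub (Finset.mem_univ c), hsum]
  simp
  ring

theorem sum_numBicolored :
    ∑ i, ∑ j with j ≠ i, (G.numBicolored i j : ℚ) =
      2 * ∑ c, (numCycles (G.wick * G.partner c) : ℚ) + 50 * n := by
  have hsum : ∑ c, ((G.colored c).card : ℚ) = n := by exact_mod_cast G.sum_card_colored
  have hstrands : ∑ c : Fin 6, ∑ c' with c' ≠ c, (G.numBicolored c.succ c'.succ : ℚ) = 50 * n := by
    simp only [sum_numBicolored_succ, Finset.sum_sub_distrib, ← Finset.mul_sum, hsum]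
    simp
    ring
  simp only [Finset.sum_filter] at hstrands ⊢
  simp only [Fin.sum_univ_succ (n := 6), Fin.succ_ne_zero, Fin.succ_inj,
    (Fin.succ_ne_zero _).symm, ne_eq, not_true, not_false_iff,
    if_true, if_false, zero_add, Finset.sum_add_distrib, G.numBicolored_comm (Fin.succ _) 0,
    numBicolored_zero_succ]
  rw [hstrands]
  ring

theorem degree_eq :
    G.degree = (fullCycles (Fin 7)).card / 12 *
      (6 + 5 * n - ∑ c, (numCycles (G.wick * G.partner c) : ℚ)) := by
  have hdegree : G.degree = (∑ ξ ∈ fullCycles (Fin 7), G.jacketGenus ξ) / 2 := rfl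
  have hsum := card_sub_one_mul_sum_fullCycles fun i j => (G.numBicolored i j : ℚ)
  rw [sum_numBicolored] at hsum
  simp only [hdegree, jacketGenus]
  rw [Finset.sum_sub_distrib, ← Finset.sum_div, Finset.sum_add_distrib]
  simp only [Finset.sum_const, nsmul_eq_mul]
  simp only [Fintype.card_fin] at hsum
  norm_num at hsum
  linarith

theorem isMelonic_iff (h : IsConnectedMap G.wick) :
    G.IsMelonic ↔ numCycles G.wick = n + 1 := by
  have hcycles : ((fullCycles (Fin 7)).card / 12 : ℚ) ≠ 0 := by
    have := (fullCycles_fin_nonempty 5).card_ne_zero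
    simpa using this
  have htree := h.sum_numCycles_mul_exchange_add_card_eq_iff (by simp) G.color
  simp only [Fintype.card_fin] at htree
  rw [← htree, IsMelonic, degree_eq, mul_eq_zero, or_iff_right hcycles, sub_eq_zero, eq_comm]
  simp only [partner_eq_exchange]
  norm_cast
  change _ ↔ ∑ c, numCycles (G.wick * exchange (G.colored c)) + n = 6 * (n + 1)
  omega

end FeynmanGraph

/-! ### Fields of gauge-invariant momenta -/

section Fields

variable (𝕜 : Type*) [Field 𝕜] {ι D : Type*} [Fintype ι]

/-- The gauge-invariant momenta, that is those of sum zero, whose components in `T` vanish. -/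
def gaugeSpace (T : Finset ι) : Submodule 𝕜 (ι → 𝕜) where
  carrier := {x | ∑ c, x c = 0 ∧ ∀ c ∈ T, x c = 0}
  add_mem' := fun ⟨hx, hx'⟩ ⟨hy, hy'⟩ =>
    ⟨by simp [Finset.sum_add_distrib, hx, hy], fun c hc => by simp [hx' c hc, hy' c hc]⟩
  zero_mem' := by simp
  smul_mem' := fun a _ ⟨hx, hx'⟩ =>
    ⟨by simp [← Finset.mul_sum, hx], fun c hc => by simp [hx' c hc]⟩

theorem finrank_gaugeSpace_le (T : Finset ι) :
    finrank 𝕜 (gaugeSpace 𝕜 T) ≤ Fintype.card ι - 1 - T.card := by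
  classical
  by_cases hT : ∃ i, i ∉ T
  · obtain ⟨i, hi⟩ := hT
    have hrestrict := finrank_le_finrank_add_of_inf_ker_le (W := gaugeSpace 𝕜 T) (W' := ⊥) (R := ⊤)
      (LinearMap.funLeft 𝕜 𝕜 (Subtype.val : {c // c ∉ insert i T} → ι)) (fun _ _ => trivial) (by
        rintro x ⟨⟨hsum, hx⟩, hker⟩
        have hoff (c : ι) (hc : c ≠ i) : x c = 0 := by
          by_cases hcT : c ∈ T
          · exact hx c hcT
          · exact congrFun hker ⟨c, by simp [hc, hcT]⟩
        rw [Finset.sum_eq_single i (fun c _ => hoff c) (by simp)] at hsum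
        exact (Submodule.mem_bot 𝕜).2 <| funext fun c => by
          rcases eq_or_ne c i with rfl | hc
          exacts [hsum, hoff c hc])
    rw [finrank_bot, finrank_top, finrank_fintype_fun_eq_card, Fintype.card_subtype_compl,
      Fintype.card_coe, Finset.card_insert_of_notMem hi] at hrestrict
    omega
  · have hbot : gaugeSpace 𝕜 T = ⊥ := by
      push Not at hT
      exact (Submodule.eq_bot_iff _).2 fun x hx => funext fun c => hx.2 c (hT c)
    rw [hbot, finrank_bot]
    exact Nat.zero_le _

/-- The fields of gauge-invariant momenta whose component of colour `c` is constant along `E c` and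
that vanish on `X`. -/
def fieldSpace (E : ι → D → D → Prop) (X : Finset D) : Submodule 𝕜 (D → ι → 𝕜) where
  carrier := {K | (∀ d, ∑ c, K d c = 0) ∧ (∀ c d d', E c d d' → K d c = K d' c) ∧
    ∀ d ∈ X, K d = 0}
  add_mem' := fun ⟨h₁, h₂, h₃⟩ ⟨h₁', h₂', h₃'⟩ =>
    ⟨fun d => by simp [Finset.sum_add_distrib, h₁, h₁'],
      fun c d d' h => by simp [h₂ c d d' h, h₂' c d d' h],
      fun d hd => by simp [h₃ d hd, h₃' d hd]⟩
  zero_mem' := by simp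
  smul_mem' := fun r _ ⟨h₁, h₂, h₃⟩ =>
    ⟨fun d => by simp [← Finset.mul_sum, h₁], fun c d d' h => by simp [h₂ c d d' h],
      fun d hd => by simp [h₃ d hd]⟩

/-- The relations `E c` together connect `D`: one of them crosses the boundary of any subset. -/
def IsColorConnected (E : ι → D → D → Prop) : Prop :=
  ∀ Y : Set D, Y.Nonempty → Y ≠ Set.univ → ∃ c, ∃ d ∈ Y, ∃ d' ∉ Y, E c d d'

variable {E : ι → D → D → Prop}

theorem finrank_fieldSpace_le_insert [Finite D] [DecidableEq D] {X : Finset D} {b : D}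
    {T : Finset ι} (hT : ∀ c ∈ T, ∃ d ∈ X, E c d b) :
    finrank 𝕜 (fieldSpace 𝕜 E X) ≤
      finrank 𝕜 (fieldSpace 𝕜 E (insert b X)) + (Fintype.card ι - 1 - T.card) := by
  refine (finrank_le_finrank_add_of_inf_ker_le (R := gaugeSpace 𝕜 T)
    (LinearMap.proj (R := 𝕜) (φ := fun _ : D => ι → 𝕜) b) ?_ ?_).trans
    (Nat.add_le_add_left (finrank_gaugeSpace_le 𝕜 T) _)
  · rintro K ⟨hsum, hlink, hzero⟩
    refine ⟨hsum b, fun c hc => ?_⟩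
    obtain ⟨d, hd, hE⟩ := hT c hc
    simp [← hlink c d b hE, hzero d hd]
  · rintro K ⟨⟨hsum, hlink, hzero⟩, hb⟩
    exact ⟨hsum, hlink, Finset.forall_mem_insert b X _ |>.2 ⟨hb, hzero⟩⟩

variable [Fintype D]

theorem finrank_fieldSpace_add_le (hE : IsColorConnected E) {X : Finset D} (hX : X.Nonempty) :
    finrank 𝕜 (fieldSpace 𝕜 E X) + (Fintype.card ι - 2) * X.card ≤
      (Fintype.card ι - 2) * Fintype.card D := by
  classical
  induction X using WellFoundedGT.induction with
  | _ X ih =>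
    by_cases huniv : X = Finset.univ
    · have hbot : fieldSpace 𝕜 E X = ⊥ := (Submodule.eq_bot_iff _).2 fun K hK =>
        funext fun d => hK.2.2 d (huniv ▸ Finset.mem_univ d)
      rw [hbot, finrank_bot, huniv, Finset.card_univ, zero_add]
    · obtain ⟨c, d, hd, d', hd', hdd'⟩ := hE X hX (by exact_mod_cast huniv)
      have hstep := finrank_fieldSpace_le_insert 𝕜 (T := {c}) (by simpa using ⟨d, hd, hdd'⟩)
      have hrest := ih (insert d' X) (Finset.ssubset_insert hd') (Finset.insert_nonempty _ _)
      rw [Finset.card_insert_of_notMem hd', mul_add_one] at hrest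
      rw [Finset.card_singleton] at hstep
      omega

theorem finrank_fieldSpace_add_lt_of_ne (hE : IsColorConnected E) (hι : 3 ≤ Fintype.card ι)
    {X : Finset D} {b d d' : D} {c c' : ι} (hcc' : c ≠ c') (hb : b ∉ X) (hd : d ∈ X)
    (hd' : d' ∈ X) (hdb : E c d b) (hdb' : E c' d' b) :
    finrank 𝕜 (fieldSpace 𝕜 E X) + (Fintype.card ι - 2) * X.card <
      (Fintype.card ι - 2) * Fintype.card D := by
  classical
  have hstep := finrank_fieldSpace_le_insert 𝕜 (E := E) (X := X) (b := b) (T := {c, c'}) (by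
    simpa using ⟨⟨d, hd, hdb⟩, ⟨d', hd', hdb'⟩⟩)
  have hrest := finrank_fieldSpace_add_le 𝕜 hE (Finset.insert_nonempty b X)
  rw [Finset.card_insert_of_notMem hb, mul_add_one] at hrest
  rw [Finset.card_pair hcc'] at hstep
  omega

/-- Exploring the disks from `Y`, the first disk linked to `b` is linked to `Y` by another colour,
and so meets two constraints. -/
theorem finrank_fieldSpace_insert_add_lt [DecidableEq D] (hE : IsColorConnected E)
    (hι : 3 ≤ Fintype.card ι) (hequiv : ∀ c, Equivalence (E c)) {b : D} {Y : Finset D}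
    (hY : Y.Nonempty) (hb : b ∉ Y) (hYb : ∀ d ∈ Y, ∀ c, ¬ E c d b) :
    finrank 𝕜 (fieldSpace 𝕜 E (insert b Y)) + (Fintype.card ι - 2) * (insert b Y).card <
      (Fintype.card ι - 2) * Fintype.card D := by
  induction Y using WellFoundedGT.induction with
  | _ Y ih =>
    obtain ⟨c, d, hd, d', hd', hdd'⟩ := hE Y hY fun h =>
      hb (Finset.coe_eq_univ.1 h ▸ Finset.mem_univ b)
    have hne : d' ≠ b := fun h => hYb d hd c (h ▸ hdd')
    have hd'ins : d' ∉ insert b Y := by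
      rw [Finset.mem_insert, not_or]
      exact ⟨hne, hd'⟩
    by_cases hd'b : ∃ c', E c' d' b
    · obtain ⟨c', hc'⟩ := hd'b
      have hcc' : c ≠ c' := fun h => hYb d hd c' ((hequiv c').trans (h ▸ hdd') hc')
      exact finrank_fieldSpace_add_lt_of_ne 𝕜 hE hι hcc' hd'ins (Finset.mem_insert_of_mem hd)
        (Finset.mem_insert_self b Y) hdd' ((hequiv c').symm hc')
    · have hstep := finrank_fieldSpace_le_insert 𝕜 (X := insert b Y) (T := {c})
        (by simpa using Or.inr ⟨d, hd, hdd'⟩)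
      have hrest := ih (insert d' Y) (Finset.ssubset_insert hd') (Finset.insert_nonempty _ _)
        (by simpa [hb] using hne.symm)
        (Finset.forall_mem_insert d' Y _ |>.2 ⟨not_exists.1 hd'b, hYb⟩)
      rw [Finset.insert_comm, Finset.card_insert_of_notMem hd'ins, mul_add_one] at hrest
      rw [Finset.card_singleton] at hstep
      omega

end Fields

/-! ### The divergence degree -/

namespace FeynmanGraph

variable {n N : ℕ} (G : FeynmanGraph n N)

/-- The attributions of gauge-invariant momenta to the disks, seen as functions of the arcs: a
vertex imposes the equality of the components of its colour of the momenta of its two disks. -/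
structure IsDiskMomentum {R : Type*} [AddCommMonoid R] (K : Half n → Fin 6 → R) : Prop where
  sum_eq_zero : ∀ d, ∑ c, K d c = 0
  wick_apply : ∀ d, K (G.wick d) = K d
  strand_apply : ∀ d, K (d.1, !d.2) (G.color d.1) = K d (G.color d.1)

variable {G}

theorem IsDiskMomentum.apply_partner {R : Type*} [AddCommMonoid R] {K : Half n → Fin 6 → R}
    (hK : G.IsDiskMomentum K) (d : Half n) (c : Fin 6) :
    K (G.wick.symm d) c = K (G.partner c d) c := by
  rw [← hK.wick_apply (G.wick.symm d), apply_symm_apply, partner_apply]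
  split_ifs with hc
  exacts [hc ▸ (hK.strand_apply d).symm, rfl]

/-- Across a vertex five of the six components of the momentum are conserved along the disk, hence
by gauge invariance so is the sixth. -/
theorem isDiskMomentum_of_gauge {R : Type*} [AddCommGroup R] {K : Half n → Fin 6 → R}
    (hgauge : ∀ d, ∑ c, K d c = 0)
    (hstrand : ∀ d c, K (G.wick.symm d) c = K (G.partner c d) c) : G.IsDiskMomentum K := by
  have hoff (d : Half n) (c : Fin 6) (hc : c ≠ G.color d.1) : K (G.wick.symm d) c = K d c := by
    rw [hstrand, partner_apply, if_neg hc.symm]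
  have hsymm (d : Half n) : K (G.wick.symm d) = K d := by
    ext c
    by_cases hc : c = G.color d.1
    · have hsum := (hgauge (G.wick.symm d)).trans (hgauge d).symm
      rw [← Finset.add_sum_erase _ _ (Finset.mem_univ c),
        ← Finset.add_sum_erase _ (K d) (Finset.mem_univ c),
        Finset.sum_congr rfl fun a ha => hoff d a (hc ▸ Finset.ne_of_mem_erase ha)] at hsum
      exact add_right_cancel hsum
    · exact hoff d c hc
  refine ⟨hgauge, fun d => by simpa using (hsymm (G.wick d)).symm, fun d => ?_⟩
  have hcolor := hstrand d (G.color d.1)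
  rwa [hsymm, partner_apply, if_pos rfl, eq_comm] at hcolor

variable (G)

/-- The disks of the intermediate field representation. -/
abbrev Disk : Type := Quotient (Perm.SameCycle.setoid G.wick)

/-- The disk through an arc. -/
def diskOf (d : Half n) : G.Disk := Quotient.mk _ d

instance : Fintype G.Disk := Fintype.ofFinite _

theorem card_disk : Fintype.card G.Disk = numCycles G.wick := by
  rw [← Nat.card_eq_fintype_card, numCycles]

/-- Two arcs are `c`-linked if their disks are joined by a path of wavy edges of colour `c`. -/
def MonoLinked (c : Fin 6) : Half n → Half n → Prop :=
  Relation.EqvGen fun d d' => G.wick.SameCycle d d' ∨ (G.color d.1 = c ∧ d' = (d.1, !d.2))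

/-- Two disks are `c`-linked if they are joined by a path of wavy edges of colour `c`. -/
def DiskLinked (c : Fin 6) (X Y : G.Disk) : Prop := G.MonoLinked c X.out Y.out

variable {G}

theorem diskOf_eq_iff {d d' : Half n} : G.diskOf d = G.diskOf d' ↔ G.wick.SameCycle d d' :=
  Quotient.eq

theorem sameCycle_out_diskOf (d : Half n) : G.wick.SameCycle (G.diskOf d).out d :=
  diskOf_eq_iff.1 (Quotient.out_eq (G.diskOf d))

theorem monoLinked_equivalence (c : Fin 6) : Equivalence (G.MonoLinked c) :=
  Relation.EqvGen.is_equivalence _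

theorem MonoLinked.of_sameCycle {c : Fin 6} {d d' : Half n} (h : G.wick.SameCycle d d') :
    G.MonoLinked c d d' := Relation.EqvGen.rel _ _ (Or.inl h)

theorem monoLinked_color (d : Half n) : G.MonoLinked (G.color d.1) d (d.1, !d.2) :=
  Relation.EqvGen.rel _ _ (Or.inr ⟨rfl, rfl⟩)

theorem diskLinked_diskOf {c : Fin 6} {d d' : Half n} :
    G.DiskLinked c (G.diskOf d) (G.diskOf d') ↔ G.MonoLinked c d d' := by
  have hout (e : Half n) : G.MonoLinked c (G.diskOf e).out e :=
    .of_sameCycle (sameCycle_out_diskOf e)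
  have heq := monoLinked_equivalence (G := G) c
  exact ⟨fun h => heq.trans (heq.trans (heq.symm (hout d)) h) (hout d'),
    fun h => heq.trans (heq.trans (hout d) h) (heq.symm (hout d'))⟩

theorem diskLinked_equivalence (c : Fin 6) : Equivalence (G.DiskLinked c) :=
  (monoLinked_equivalence c).comap _

theorem IsDiskMomentum.apply_eq_of_monoLinked {R : Type*} [AddCommMonoid R]
    {K : Half n → Fin 6 → R} (hK : G.IsDiskMomentum K) {c : Fin 6} {d d' : Half n}
    (h : G.MonoLinked c d d') : K d c = K d' c := by
  induction h with
  | rel d d' h =>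
    rcases h with h | ⟨rfl, rfl⟩
    · rw [apply_eq_of_sameCycle hK.wick_apply h]
    · exact (hK.strand_apply d).symm
  | refl d => rfl
  | symm d d' _ ih => exact ih.symm
  | trans d d' d'' _ _ ih ih' => exact ih.trans ih'

theorem isColorConnected_diskLinked (h : IsConnectedMap G.wick) :
    IsColorConnected G.DiskLinked := by
  classical
  intro Y ⟨X, hX⟩ huniv
  by_contra! hclosed
  have hinvariant : (fun d => if G.diskOf d ∈ Y then (1 : ℚ) else 0) ∈
      componentFunctions G.wick Finset.univ := by
    have hvertex (d : Half n) (hd : G.diskOf d ∈ Y) : G.diskOf (d.1, !d.2) ∈ Y := by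
      by_contra hd'
      exact hclosed _ _ hd _ hd' (diskLinked_diskOf.2 (monoLinked_color d))
    refine ⟨mem_invariants.2 fun d => ?_, mem_invariants_exchange.2 fun v _ => ?_⟩
    · simp only [diskOf_eq_iff.2 (Perm.sameCycle_apply_left.2 (Perm.SameCycle.refl G.wick d))]
    · simp only [show G.diskOf (v, false) ∈ Y ↔ G.diskOf (v, true) ∈ Y from
        ⟨hvertex (v, false), hvertex (v, true)⟩]
  refine huniv (Set.eq_univ_of_forall fun X' => ?_)
  have heq := h _ hinvariant X.out X'.out
  by_contra hX'
  simp [diskOf, hX, hX'] at heq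

variable (G)

theorem faceOf_wick_symm (c : Fin 6) (d : Half n) :
    G.faceOf c (G.wick.symm d) = G.faceOf c (G.partner c d) :=
  Quotient.sound ⟨1, by simp [facePerm]⟩

/-- The component of colour `c` of the momentum of the arc `d`, as a function of the momenta that
circulate in the internal faces. -/
def faceMomentum (c : Fin 6) (d : Half n) : (G.InternalFace → ℚ) →ₗ[ℚ] ℚ :=
  LinearMap.proj (⟨c, G.faceOf c d⟩ : Σ c, G.Face c) ∘ₗ
    Function.ExtendByZero.linearMap ℚ Subtype.val

theorem faceMomentum_faceOf {c : Fin 6} {d : Half n}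
    (h : ∀ j, G.faceOf c (G.cilium j) ≠ G.faceOf c d) (x : G.InternalFace → ℚ) :
    G.faceMomentum c d x = x ⟨⟨c, G.faceOf c d⟩, h⟩ :=
  Subtype.val_injective.extend_apply x 0 ⟨⟨c, G.faceOf c d⟩, h⟩

theorem faceMomentum_cilium (c : Fin 6) (j : Fin N) (x : G.InternalFace → ℚ) :
    G.faceMomentum c (G.cilium j) x = 0 :=
  Function.extend_apply' _ _ _ fun ⟨f, hf⟩ => f.2 j (by rw [hf])

theorem sum_faceMomentum (l : G.Line) (x : G.InternalFace → ℚ) :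
    ∑ c, G.faceMomentum c l.1 x = (G.incidence.mulVec x) l := by
  classical
  have hext (F : Σ c, G.Face c) (hF : F ∉ Set.range (Subtype.val : G.InternalFace → _)) :
      Function.extend (Subtype.val : G.InternalFace → _) x 0 F = 0 :=
    Function.extend_apply' _ _ _ hF
  have : ∀ c, Fintype (G.Face c) := fun c => Fintype.ofFinite _
  rw [Matrix.mulVec, dotProduct, Fintype.sum_of_injective Subtype.val Subtype.val_injective
    (fun f => G.incidence l f * x f)
    (fun F => if G.faceOf F.1 l.1 = F.2 then Function.extend Subtype.val x 0 F else 0)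
    (fun F hF => by rw [hext F hF, ite_self])
    (fun f => by rw [incidence, Subtype.val_injective.extend_apply, ite_mul, one_mul, zero_mul]),
    Fintype.sum_sigma]
  exact Finset.sum_congr rfl fun c _ => (Fintype.sum_ite_eq (G.faceOf c l.1) fun F =>
    Function.extend Subtype.val x 0 (⟨c, F⟩ : Σ c, G.Face c)).symm

theorem isDiskMomentum_faceMomentum {x : G.InternalFace → ℚ}
    (hx : x ∈ LinearMap.ker G.incidence.mulVecLin) :
    G.IsDiskMomentum fun d c => G.faceMomentum c d x := by
  refine isDiskMomentum_of_gauge (fun d => ?_) fun d c => ?_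
  · by_cases hd : d ∈ Set.range G.cilium
    · obtain ⟨j, rfl⟩ := hd
      simp only [faceMomentum_cilium, Finset.sum_const_zero]
    · exact (G.sum_faceMomentum ⟨d, hd⟩ x).trans (congrFun (LinearMap.mem_ker.1 hx) _)
  · simp only [faceMomentum, G.faceOf_wick_symm]

theorem eq_zero_of_faceMomentum_eq_zero {x : G.InternalFace → ℚ}
    (hx : ∀ c d, G.faceMomentum c d x = 0) : x = 0 := by
  ext ⟨⟨c, F⟩, hF⟩
  obtain ⟨d, rfl⟩ := Quotient.mk_surjective F
  exact (G.faceMomentum_faceOf hF x).symm.trans (hx c d)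

/-- The ciliated disks. -/
def ciliated : Finset G.Disk :=
  open Classical in Finset.univ.image fun j => G.diskOf (G.cilium j)

variable {G} in
theorem mem_ciliated {X : G.Disk} : X ∈ G.ciliated ↔ ∃ j, G.diskOf (G.cilium j) = X := by
  simp [ciliated]

theorem card_ciliated : G.ciliated.card = N := by
  classical
  rw [ciliated, Finset.card_image_of_injective _ fun i j h =>
    G.eq_of_sameCycle i j (diskOf_eq_iff.1 h), Finset.card_univ, Fintype.card_fin]

theorem cilium_injective : Function.Injective G.cilium := fun i j h =>
  G.eq_of_sameCycle i j (h ▸ Perm.SameCycle.refl _ _)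

theorem card_line_add : Fintype.card G.Line + N = 2 * n := by
  have hrange := Set.ncard_add_ncard_compl (Set.range G.cilium)
  rw [← Nat.card_coe_set_eq, Nat.card_range_of_injective G.cilium_injective, Nat.card_fin,
    ← Nat.card_coe_set_eq, Nat.card_prod, Nat.card_fin, Nat.card_eq_fintype_card (α := Bool),
    Fintype.card_bool] at hrange
  have hline : Fintype.card G.Line = Nat.card ↥(Set.range G.cilium)ᶜ :=
    Nat.card_eq_fintype_card.symm
  omega

/-- The kernel of the incidence matrix consists of the loop momenta that are compatible with the
gauge constraint on all the internal lines. -/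
theorem finrank_ker_incidence_le :
    finrank ℚ (LinearMap.ker G.incidence.mulVecLin) ≤
      finrank ℚ (fieldSpace ℚ G.DiskLinked G.ciliated) := by
  have hout {x : G.InternalFace → ℚ} (hx : x ∈ LinearMap.ker G.incidence.mulVecLin) (c : Fin 6)
      (d : Half n) : G.faceMomentum c (G.diskOf d).out x = G.faceMomentum c d x :=
    congrFun (apply_eq_of_sameCycle (φ := fun d c => G.faceMomentum c d x)
      (G.isDiskMomentum_faceMomentum hx).wick_apply
      (sameCycle_out_diskOf d)) c
  have hker := finrank_le_finrank_add_of_inf_ker_le (W := LinearMap.ker G.incidence.mulVecLin)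
    (W' := ⊥) (R := fieldSpace ℚ G.DiskLinked G.ciliated)
    (LinearMap.pi fun X => LinearMap.pi fun c => G.faceMomentum c X.out) ?_ ?_
  · rwa [finrank_bot, zero_add] at hker
  · intro x hx
    have hdisk := G.isDiskMomentum_faceMomentum hx
    refine ⟨fun X => hdisk.sum_eq_zero _, fun c X Y h => hdisk.apply_eq_of_monoLinked h, ?_⟩
    rintro X hX
    obtain ⟨j, rfl⟩ := mem_ciliated.1 hX
    exact funext fun c => (hout hx c _).trans (G.faceMomentum_cilium c j x)
  · rintro x ⟨hx, hzero⟩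
    exact (Submodule.mem_bot ℚ).2 <| G.eq_zero_of_faceMomentum_eq_zero fun c d =>
      (hout hx c d).symm.trans (congrFun (congrFun hzero (G.diskOf d)) c)

theorem divergenceDegree_le :
    G.divergenceDegree ≤ finrank ℚ (fieldSpace ℚ G.DiskLinked G.ciliated) -
      2 * (2 * (n : ℤ) - N) := by
  have hrank := LinearMap.finrank_range_add_finrank_ker G.incidence.mulVecLin
  rw [finrank_fintype_fun_eq_card] at hrank
  have hker := G.finrank_ker_incidence_le
  have hline := G.card_line_add
  rw [divergenceDegree, Matrix.rank]
  omega

theorem divergenceDegree_le_numCycles (h : IsConnectedMap G.wick) (hN : N ≠ 0) :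
    G.divergenceDegree ≤ 4 * ((numCycles G.wick : ℤ) - n) - 2 * N := by
  have hdegree := G.divergenceDegree_le
  have hfields := finrank_fieldSpace_add_le ℚ (isColorConnected_diskLinked h)
    (X := G.ciliated) (Finset.card_ne_zero.1 (by rwa [card_ciliated]))
  rw [card_ciliated, card_disk, Fintype.card_fin] at hfields
  omega

theorem divergenceDegree_neg_of_not_isMelonic (h : IsConnectedMap G.wick) (hN : N ≠ 0)
    (hG : ¬ G.IsMelonic) : G.divergenceDegree < 0 := by
  have hdegree := G.divergenceDegree_le_numCycles h hN
  have htree := h.numCycles_le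
  rw [G.isMelonic_iff h] at hG
  rw [Fintype.card_fin] at htree
  omega

theorem divergenceDegree_neg_of_three_le (h : IsConnectedMap G.wick) (hN : 3 ≤ N) :
    G.divergenceDegree < 0 := by
  have hdegree := G.divergenceDegree_le_numCycles h (by omega)
  have htree := h.numCycles_le
  rw [Fintype.card_fin] at htree
  omega

theorem divergenceDegree_neg_of_not_isMono (G : FeynmanGraph n 2) (h : IsConnectedMap G.wick)
    (hG : ∀ c, ¬ G.IsMono c) : G.divergenceDegree < 0 := by
  classical
  have hciliated : G.ciliated = insert (G.diskOf (G.cilium 1)) {G.diskOf (G.cilium 0)} := by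
    ext X
    simp only [mem_ciliated, Fin.exists_fin_two, Finset.mem_insert, Finset.mem_singleton]
    rw [or_comm, eq_comm, eq_comm (b := X)]
  have hfields := finrank_fieldSpace_insert_add_lt ℚ (isColorConnected_diskLinked h)
    (by simp) diskLinked_equivalence (b := G.diskOf (G.cilium 1))
    (Finset.singleton_nonempty (G.diskOf (G.cilium 0)))
    (fun hmem => by simpa using
      G.eq_of_sameCycle 1 0 (diskOf_eq_iff.1 (Finset.mem_singleton.1 hmem)))
    (fun X hX c => by rw [Finset.mem_singleton.1 hX, diskLinked_diskOf]; exact hG c)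
  have hdegree := G.divergenceDegree_le
  have htree := h.numCycles_le
  rw [← hciliated, card_ciliated, card_disk, Fintype.card_fin] at hfields
  rw [Fintype.card_fin] at htree
  omega

end FeynmanGraph

/-! ### Melonic one-particle irreducible graphs -/

namespace FeynmanGraph

variable {n N : ℕ} {G : FeynmanGraph n N}

theorem isConnectedMap_of_connected {S : Set (Half n)} {w : Perm (Half n)}
    (hw : ∀ d ∈ S, w d = G.wick d) (h : (G.vertexGraph S).Connected) : IsConnectedMap w := by
  rintro φ ⟨hφ, hφ'⟩
  have hvertex (d : Half n) : φ d = φ (d.1, false) := by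
    rcases d with ⟨v, _ | _⟩
    exacts [rfl, (mem_invariants_exchange.1 hφ' v (Finset.mem_univ v)).symm]
  have harc {d : Half n} (hd : d ∈ S) : φ (d.1, false) = φ ((G.wick d).1, false) := by
    rw [← hvertex, ← hvertex, ← hw d hd, mem_invariants.1 hφ]
  have hadj {v u : Fin n} (hvu : (G.vertexGraph S).Adj v u) : φ (v, false) = φ (u, false) := by
    rcases ((SimpleGraph.fromRel_adj _ _ _).1 hvu).2 with ⟨d, hd, rfl, rfl⟩ | ⟨d, hd, rfl, rfl⟩
    exacts [harc hd, (harc hd).symm]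
  have hwalk {v u : Fin n} (p : (G.vertexGraph S).Walk v u) : φ (v, false) = φ (u, false) := by
    induction p with
    | nil => rfl
    | cons hvu _ ih => exact (hadj hvu).trans ih
  intro d d'
  rw [hvertex d, hvertex d', hwalk (h.preconnected d.1 d'.1).some]

theorem IsOnePI.isConnectedMap (h : G.IsOnePI) : IsConnectedMap G.wick :=
  isConnectedMap_of_connected (fun _ _ => rfl) h.1

/-- In a one-particle irreducible tree the ciliated disks are leaves: otherwise the internal arc
that follows the cilium could be removed, leaving a connected map with one more disk. -/
theorem IsOnePI.wick_cilium (h : G.IsOnePI) (hG : G.IsMelonic) (j : Fin N) :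
    G.wick (G.cilium j) = G.cilium j := by
  rw [isMelonic_iff G h.isConnectedMap] at hG
  by_contra hne
  set d := G.wick (G.cilium j)
  have hinternal : d ∉ Set.range G.cilium := by
    rintro ⟨i, hi⟩
    have hij : j = i := G.eq_of_sameCycle j i ⟨1, by rw [hi, zpow_one]⟩
    exact hne (by rw [← hi, hij])
  have hconnected : IsConnectedMap (G.wick * swap d (G.cilium j)) := by
    refine isConnectedMap_of_connected ?_ (h.2 d hinternal)
    rintro e ⟨he, hed⟩
    rw [Perm.mul_apply, swap_apply_of_ne_of_ne hed]
    rintro rfl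
    exact he ⟨j, rfl⟩
  have hfixed : (G.wick * swap d (G.cilium j)) d = d := by
    rw [Perm.mul_apply, swap_apply_left]
  have hcount := numCycles_mul_swap_add_one (σ := G.wick * swap d (G.cilium j))
    fun hcycle => hne (hcycle.eq_of_left hfixed)
  rw [mul_assoc, swap_mul_self, mul_one] at hcount
  have htree := hconnected.numCycles_le
  rw [Fintype.card_fin] at htree
  omega

theorem MonoLinked.color_eq {c : Fin 6} {d d' : Half n} (h : G.MonoLinked c d d') (hne : d ≠ d')
    (hd : G.wick d = d) : G.color d.1 = c := by
  by_contra hc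
  have hisolated {e e' : Half n} (hee' : G.MonoLinked c e e') : e = d ↔ e' = d := by
    induction hee' with
    | rel e e' hee' =>
      rcases hee' with hcycle | ⟨hcolor, rfl⟩
      · constructor
        · rintro rfl
          exact (hcycle.eq_of_left hd).symm
        · rintro rfl
          exact hcycle.eq_of_right hd
      · constructor <;> rintro rfl <;> exact (hc hcolor).elim
    | refl e => exact Iff.rfl
    | symm e e' _ ih => exact ih.symm
    | trans e e' e'' _ _ ih ih' => exact ih.trans ih'
  exact hne ((hisolated h).1 rfl).symm

theorem IsOnePI.color_cilium {G : FeynmanGraph n 2} (h : G.IsOnePI) (hG : G.IsMelonic)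
    {c : Fin 6} (hc : G.IsMono c) (j : Fin 2) : G.color (G.cilium j).1 = c := by
  have hne : G.cilium 0 ≠ G.cilium 1 := G.cilium_injective.ne zero_ne_one
  have hlinked : G.MonoLinked c (G.cilium 0) (G.cilium 1) := hc
  fin_cases j
  · exact hlinked.color_eq hne (h.wick_cilium hG 0)
  · exact ((monoLinked_equivalence c).symm hlinked).color_eq hne.symm (h.wick_cilium hG 1)

end FeynmanGraph

/-! ### Amplitudes -/

section Propagator

variable {m M : ℝ} {ρ : ℕ}

theorem propagator_nonneg (p : Momentum) : 0 ≤ propagator m M ρ p := by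
  rw [propagator]
  split_ifs
  · positivity
  · exact le_rfl

theorem propagator_of_sum_ne_zero {p : Momentum} (hp : ∑ c, p c ≠ 0) : propagator m M ρ p = 0 :=
  if_neg fun h => hp h.1

theorem propagator_of_lt {p : Momentum} (hp : M ^ (2 * ρ) < ∑ c, (p c : ℝ) ^ 2) :
    propagator m M ρ p = 0 :=
  if_neg fun h => h.2.not_gt hp

theorem propagator_comp_perm (π : Perm (Fin 6)) (p : Momentum) :
    propagator m M ρ (fun c => p (π c)) = propagator m M ρ p := by
  rw [propagator, propagator, Equiv.sum_comp π p, Equiv.sum_comp π fun c => (p c : ℝ) ^ 2]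

theorem finite_setOf_sum_sq_le {ι : Type*} [Fintype ι] (B : ℝ) :
    {p : ι → ℤ | ∑ c, (p c : ℝ) ^ 2 ≤ B}.Finite := by
  refine (Set.Finite.pi' fun _ => Set.finite_Icc (-⌊B⌋) ⌊B⌋).subset fun p hp c => ?_
  have hsq : (p c : ℝ) ^ 2 ≤ B :=
    (Finset.single_le_sum (fun c _ => sq_nonneg (p c : ℝ)) (Finset.mem_univ c)).trans hp
  have habs : |p c| ≤ p c ^ 2 := sq_abs (p c) ▸ Int.le_self_sq _
  refine abs_le.1 (Int.le_floor.2 (le_trans ?_ hsq))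
  exact_mod_cast habs

end Propagator

namespace FeynmanGraph

variable {n N : ℕ} (G : FeynmanGraph n N)

/-- The attributions of momenta to the arcs over which the amplitude with external momenta `p` is
summed. Those that violate the gauge constraint on an internal line are left out, since their
propagator vanishes. -/
def attributions (p : Fin N → GaugeMomentum) : Set (Half n → Momentum) :=
  {K | G.IsDiskMomentum K ∧ ∀ j, K (G.cilium j) = (p j).1}

/-- The product of the propagators of the internal lines. -/
def weight (m M : ℝ) (ρ : ℕ) (K : Half n → Momentum) : ℝ :=
  ∏ l : G.Line, propagator m M ρ (K l.1)

variable {G} {m M : ℝ} {ρ : ℕ} {p : Fin N → GaugeMomentum}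

theorem weight_nonneg (K : Half n → Momentum) : 0 ≤ G.weight m M ρ K :=
  Finset.prod_nonneg fun _ _ => propagator_nonneg _

theorem weight_eq_zero {K : Half n → Momentum} {d : Half n} (hd : d ∉ Set.range G.cilium)
    (hK : propagator m M ρ (K d) = 0) : G.weight m M ρ K = 0 :=
  Finset.prod_eq_zero (Finset.mem_univ (⟨d, hd⟩ : G.Line)) hK

theorem amplitude_eq_tsum :
    G.amplitude m M ρ p = ∑' K : G.attributions p, G.weight m M ρ K := by
  classical
  rw [tsum_subtype (G.attributions p) (G.weight m M ρ), amplitude]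
  refine tsum_congr fun K => ?_
  rw [Set.indicator_apply]
  by_cases hK : K ∈ G.attributions p
  · rw [if_pos ⟨hK.2, hK.1.apply_partner⟩, if_pos hK, weight]
  · rw [if_neg hK]
    split_ifs with h
    · obtain ⟨d, hd⟩ : ∃ d, ∑ c, K d c ≠ 0 := by
        by_contra! hgauge
        exact hK ⟨isDiskMomentum_of_gauge hgauge h.2, h.1⟩
      have hinternal : d ∉ Set.range G.cilium := by
        rintro ⟨j, rfl⟩
        exact hd (h.1 j ▸ (p j).2)
      exact weight_eq_zero hinternal (propagator_of_sum_ne_zero hd)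
    · rfl

theorem amplitude_nonneg : 0 ≤ G.amplitude m M ρ p :=
  amplitude_eq_tsum ▸ tsum_nonneg fun K => weight_nonneg K.1

theorem finite_support_weight :
    (Function.support fun K : G.attributions p => G.weight m M ρ K).Finite := by
  have hfinite := Set.Finite.pi' fun _ : Half n => (Set.finite_range fun j => (p j).1).union
    (finite_setOf_sum_sq_le (ι := Fin 6) (M ^ (2 * ρ)))
  refine Set.Finite.of_finite_image (hfinite.subset ?_) Subtype.val_injective.injOn
  rintro _ ⟨K, hK, rfl⟩ d
  by_cases hd : d ∈ Set.range G.cilium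
  · obtain ⟨j, rfl⟩ := hd
    exact Or.inl ⟨j, (K.2.2 j).symm⟩
  · exact Or.inr (le_of_not_gt fun hlt => hK (weight_eq_zero hd (propagator_of_lt hlt)))

theorem sum_weight_le_amplitude {α : Type*} {K : α → Half n → Momentum}
    (hinj : Function.Injective K) (T : Finset α) (hT : ∀ a ∈ T, K a ∈ G.attributions p) :
    ∑ a ∈ T, G.weight m M ρ (K a) ≤ G.amplitude m M ρ p := by
  have hsummable : Summable fun K : G.attributions p => G.weight m M ρ K :=
    summable_of_hasFiniteSupport finite_support_weight
  rw [amplitude_eq_tsum, ← T.sum_attach]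
  let K' : T ↪ G.attributions p :=
    ⟨fun a => ⟨K a, hT a a.2⟩, fun a b hab => Subtype.ext (hinj (congrArg Subtype.val hab))⟩
  exact (Finset.sum_map T.attach K' fun K => G.weight m M ρ K.1).symm.trans_le
    (hsummable.sum_le_tsum _ fun K _ => weight_nonneg K.1)

theorem amplitude_congr {G' : FeynmanGraph n N} {p' : Fin N → GaugeMomentum}
    (e : (Half n → Momentum) ≃ (Half n → Momentum))
    (he : ∀ K, K ∈ G.attributions p ↔ e K ∈ G'.attributions p')
    (hweight : ∀ K, G'.weight m M ρ (e K) = G.weight m M ρ K) :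
    G.amplitude m M ρ p = G'.amplitude m M ρ p' := by
  rw [amplitude_eq_tsum, amplitude_eq_tsum, ← (e.subtypeEquiv he).tsum_eq]
  exact tsum_congr fun K => (hweight K).symm

theorem MonoLinked.amplitude_eq_zero {c : Fin 6} {i j : Fin N}
    (h : G.MonoLinked c (G.cilium i) (G.cilium j)) (hp : (p i).1 c ≠ (p j).1 c) :
    G.amplitude m M ρ p = 0 := by
  have hempty : IsEmpty (G.attributions p) := ⟨fun ⟨K, hK, hcilium⟩ => hp <| by
    rw [← hcilium, ← hcilium, hK.apply_eq_of_monoLinked h]⟩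
  rw [amplitude_eq_tsum, tsum_empty]

theorem IsDiskMomentum.add_iff {R : Type*} [AddCommGroup R] {K Δ : Half n → Fin 6 → R}
    (hΔ : G.IsDiskMomentum Δ) : G.IsDiskMomentum (K + Δ) ↔ G.IsDiskMomentum K := by
  constructor <;> intro hK <;> refine ⟨fun d => ?_, fun d => ?_, fun d => ?_⟩
  · simpa [Finset.sum_add_distrib, hΔ.sum_eq_zero] using hK.sum_eq_zero d
  · simpa [hΔ.wick_apply] using hK.wick_apply d
  · simpa [hΔ.strand_apply] using hK.strand_apply d
  · simpa [Finset.sum_add_distrib, hΔ.sum_eq_zero] using hK.sum_eq_zero d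
  · simpa [hΔ.wick_apply] using hK.wick_apply d
  · simpa [hΔ.strand_apply] using hK.strand_apply d

/-- An attribution of momenta supported on ciliated leaves that vanishes on the strands of the
colours of their edges is invisible to the rest of the graph. -/
theorem isDiskMomentum_extend_cilium (hG : ∀ j, G.wick (G.cilium j) = G.cilium j)
    {R : Type*} [AddCommMonoid R] {δ : Fin N → Fin 6 → R} (hgauge : ∀ j, ∑ c, δ j c = 0)
    (hcolor : ∀ j, δ j (G.color (G.cilium j).1) = 0) :
    G.IsDiskMomentum (Function.extend G.cilium δ 0) := by
  have hextend (j : Fin N) : Function.extend G.cilium δ 0 (G.cilium j) = δ j :=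
    G.cilium_injective.extend_apply _ _ _
  have hzero (d : Half n) (hd : d ∉ Set.range G.cilium) : Function.extend G.cilium δ 0 d = 0 :=
    Function.extend_apply' _ _ _ hd
  have hleaf (d : Half n) : Function.extend G.cilium δ 0 d (G.color d.1) = 0 := by
    by_cases hd : d ∈ Set.range G.cilium
    · obtain ⟨j, rfl⟩ := hd
      rw [hextend, hcolor]
    · rw [hzero d hd, Pi.zero_apply]
  refine ⟨fun d => ?_, fun d => ?_, fun d => (hleaf (d.1, !d.2)).trans (hleaf d).symm⟩ <;>
    by_cases hd : d ∈ Set.range G.cilium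
  · obtain ⟨j, rfl⟩ := hd
    rw [hextend, hgauge]
  · simp only [hzero d hd, Pi.zero_apply, Finset.sum_const_zero]
  · obtain ⟨j, rfl⟩ := hd
    rw [hG]
  · rw [hzero d hd, hzero]
    rintro ⟨j, hj⟩
    exact hd ⟨j, G.wick.injective ((hG j).trans hj)⟩

theorem amplitude_eq_of_wick_cilium (hG : ∀ j, G.wick (G.cilium j) = G.cilium j)
    {p' : Fin N → GaugeMomentum}
    (hp : ∀ j, (p j).1 (G.color (G.cilium j).1) = (p' j).1 (G.color (G.cilium j).1)) :
    G.amplitude m M ρ p = G.amplitude m M ρ p' := by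
  set Δ := Function.extend G.cilium (fun j => (p' j).1 - (p j).1) 0 with hΔdef
  have hΔ : G.IsDiskMomentum Δ := isDiskMomentum_extend_cilium hG
    (fun j => by simp [(p j).2, (p' j).2]) fun j => by simp [hp]
  refine amplitude_congr (Equiv.addRight Δ)
    (fun K => and_congr hΔ.add_iff.symm (forall_congr' fun j => ?_))
    fun K => Finset.prod_congr rfl fun l _ => ?_
  · change _ ↔ K (G.cilium j) + Δ (G.cilium j) = _
    rw [hΔdef, G.cilium_injective.extend_apply, ← add_sub_assoc, sub_eq_iff_eq_add,
      add_comm (p' j).1, add_left_inj]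
  · change propagator m M ρ (K l.1 + Δ l.1) = _
    rw [hΔdef, Function.extend_apply' _ _ _ l.2, Pi.zero_apply, add_zero]

/-- The action of the permutations of the colours on the graphs. -/
def recolor (π : Perm (Fin 6)) : FeynmanGraph n N ≃ FeynmanGraph n N where
  toFun G := { G with color := fun v => π (G.color v) }
  invFun G := { G with color := fun v => π.symm (G.color v) }
  left_inv G := by ext1 <;> simp
  right_inv G := by ext1 <;> simp

theorem recolor_color (π : Perm (Fin 6)) (v : Fin n) : (recolor π G).color v = π (G.color v) := rfl

theorem IsOnePI.isMelonic_recolor (h : G.IsOnePI) (π : Perm (Fin 6)) :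
    (recolor π G).IsMelonic ↔ G.IsMelonic :=
  (isMelonic_iff (recolor π G) h.isConnectedMap).trans (isMelonic_iff G h.isConnectedMap).symm

theorem isMono_recolor {G : FeynmanGraph n 2} (π : Perm (Fin 6)) (c : Fin 6) :
    (recolor π G).IsMono (π c) ↔ G.IsMono c := by
  simp only [IsMono, recolor_color, π.injective.eq_iff]
  rfl

theorem isDiskMomentum_recolor {R : Type*} [AddCommMonoid R] {K : Half n → Fin 6 → R}
    (π : Perm (Fin 6)) :
    (recolor π G).IsDiskMomentum (fun d c => K d (π.symm c)) ↔ G.IsDiskMomentum K := by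
  constructor <;> intro hK <;> refine ⟨fun d => ?_, fun d => ?_, fun d => ?_⟩
  · exact (Equiv.sum_comp π.symm (K d)).symm.trans (hK.sum_eq_zero d)
  · exact π.symm.surjective.injective_comp_right (hK.wick_apply d)
  · simpa [recolor_color] using hK.strand_apply d
  · exact (Equiv.sum_comp π.symm (K d)).trans (hK.sum_eq_zero d)
  · exact congrArg (· ∘ π.symm) (hK.wick_apply d)
  · simpa [recolor_color] using hK.strand_apply d

theorem amplitude_recolor (π : Perm (Fin 6)) {p' : Fin N → GaugeMomentum}
    (hp : ∀ j, (p' j).1 = (p j).1 ∘ π.symm) :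
    (recolor π G).amplitude m M ρ p' = G.amplitude m M ρ p := by
  refine (amplitude_congr (Equiv.piCongrRight fun _ => Equiv.arrowCongr π (Equiv.refl ℤ))
    (fun K => and_congr (isDiskMomentum_recolor π).symm (forall_congr' fun j => ?_))
    fun K => Finset.prod_congr rfl fun l _ => propagator_comp_perm π.symm (K l.1)).symm
  rw [hp]
  exact π.symm.surjective.injective_comp_right.eq_iff.symm

end FeynmanGraph

/-- A gauge-invariant momentum whose component of colour `0` is `q`. -/
def strandMomentum (q : ℤ) : GaugeMomentum :=
  ⟨![q, -q, 0, 0, 0, 0], by simp [Fin.sum_univ_six]⟩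

theorem FeynmanGraph.IsOnePI.amplitude_eq_strandMomentum {n N : ℕ} {G : FeynmanGraph n N}
    (h : G.IsOnePI) (hG : G.IsMelonic) {c : Fin 6} (hc : ∀ j, G.color (G.cilium j).1 = c)
    {p : Fin N → GaugeMomentum} {q : ℤ} (hp : ∀ j, (p j).1 c = q) (m M : ℝ) (ρ : ℕ) :
    G.amplitude m M ρ p =
      (recolor (swap c 0) G).amplitude m M ρ fun _ => strandMomentum q := by
  rw [← amplitude_recolor (swap c 0) (p' := fun j => ⟨(p j).1 ∘ (swap c 0).symm,
    (Equiv.sum_comp (swap c 0).symm (p j).1).trans (p j).2⟩) fun _ => rfl]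
  refine amplitude_eq_of_wick_cilium (G := recolor (swap c 0) G) (h.wick_cilium hG) fun j => ?_
  have hj : (recolor (swap c 0) G).color ((recolor (swap c 0) G).cilium j).1 = 0 := by
    rw [recolor_color]
    exact (congrArg (swap c 0) (hc j)).trans (swap_apply_left c 0)
  simp [hj, hp, strandMomentum]

/-! ### The logarithmic divergence of the loop -/

section Propagator

variable {m M : ℝ}

/-- The propagator without cutoff. -/
def barePropagator (m : ℝ) (p : Momentum) : ℝ := 1 / (∑ c, (p c : ℝ) ^ 2 + m ^ 2)

theorem barePropagator_pos (hm : m ≠ 0) (p : Momentum) : 0 < barePropagator m p := by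
  rw [barePropagator]
  positivity

theorem sq_mul_barePropagator_le_one (p : Momentum) : m ^ 2 * barePropagator m p ≤ 1 := by
  rw [barePropagator, mul_one_div]
  exact div_le_one_of_le₀ (le_add_of_nonneg_left (by positivity)) (by positivity)

theorem eventually_propagator_eq (hM : 1 < M) (p : GaugeMomentum) :
    ∀ᶠ ρ in atTop, propagator m M ρ p.1 = barePropagator m p.1 := by
  have hcutoff : Tendsto (fun ρ : ℕ => M ^ (2 * ρ)) atTop atTop := by
    simp_rw [pow_mul]
    exact tendsto_pow_atTop_atTop_of_one_lt (one_lt_pow₀ hM two_ne_zero)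
  filter_upwards [hcutoff.eventually_ge_atTop (∑ c, (p.1 c : ℝ) ^ 2)] with ρ hρ
  exact if_pos ⟨p.2, hρ⟩

/-- The gauge-invariant momentum with given first five components. -/
def completeMomentum (a : Fin 5 → ℤ) : GaugeMomentum :=
  ⟨Fin.snoc (α := fun _ => ℤ) a (-∑ i, a i), (Fin.sum_snoc _ _).trans (add_neg_cancel _)⟩

theorem completeMomentum_injective : Function.Injective completeMomentum := fun _ _ h =>
  (Fin.snoc_injective2 (α := fun _ => ℤ) (congrArg Subtype.val h)).1

theorem sum_sq_completeMomentum_le (a : Fin 5 → ℤ) :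
    ∑ c, ((completeMomentum a).1 c : ℝ) ^ 2 ≤ 6 * ∑ i, (a i : ℝ) ^ 2 := by
  have hlast := sq_sum_le_card_mul_sum_sq (s := Finset.univ) (f := fun i => (a i : ℝ))
  rw [Finset.card_fin, Nat.cast_ofNat] at hlast
  rw [Fin.sum_univ_castSucc]
  simp only [completeMomentum, Fin.snoc_castSucc, Fin.snoc_last, Int.cast_neg, Int.cast_sum,
    neg_sq]
  linarith

/-- The momenta of colour-`0` component `x` at distance of order `L` from the origin. -/
def shellMomentum (x : ℤ) (s : Σ L : ℕ, Fin 3 → Fin (L + 1)) : GaugeMomentum :=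
  completeMomentum (Fin.cons x (Fin.cons (s.1 + 1 : ℤ) fun i => (s.2 i : ℤ)))

theorem shellMomentum_injective (x : ℤ) : Function.Injective (shellMomentum x) := by
  rintro ⟨L, t⟩ ⟨L', t'⟩ h
  obtain ⟨hL, ht⟩ := Fin.cons_injective2 (Fin.cons_injective2 (completeMomentum_injective h)).2
  obtain rfl : L = L' := by simpa using hL
  congr 1
  ext i
  simpa using congrFun ht i

theorem shellMomentum_apply_zero (x : ℤ) (s : Σ L : ℕ, Fin 3 → Fin (L + 1)) :
    (shellMomentum x s).1 0 = x := rfl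

theorem le_barePropagator_shellMomentum (hm : m ≠ 0) (x : ℤ) (L : ℕ) (t : Fin 3 → Fin (L + 1)) :
    1 / ((6 * x ^ 2 + 24 + m ^ 2) * (L + 1 : ℝ) ^ 2) ≤
      barePropagator m (shellMomentum x ⟨L, t⟩).1 := by
  have hL : 1 ≤ (L + 1 : ℝ) ^ 2 := one_le_pow₀ (by linarith [L.cast_nonneg (α := ℝ)])
  have ht (i : Fin 3) : ((t i : ℕ) : ℝ) ^ 2 ≤ (L + 1 : ℝ) ^ 2 :=
    pow_le_pow_left₀ (Nat.cast_nonneg _) (by exact_mod_cast (t i).isLt.le) 2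
  refine one_div_le_one_div_of_le (by positivity) ?_
  calc ∑ c, ((shellMomentum x ⟨L, t⟩).1 c : ℝ) ^ 2 + m ^ 2
      ≤ 6 * (x ^ 2 + ((L + 1 : ℝ) ^ 2 + ∑ i, ((t i : ℕ) : ℝ) ^ 2)) + m ^ 2 := by
        gcongr
        refine (sum_sq_completeMomentum_le _).trans_eq ?_
        simp [Fin.sum_univ_succ (n := 4), Fin.sum_univ_succ (n := 3)]
    _ ≤ 6 * (x ^ 2 + ((L + 1 : ℝ) ^ 2 + 3 * (L + 1 : ℝ) ^ 2)) + m ^ 2 := by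
        gcongr
        exact (Finset.sum_le_card_nsmul _ _ _ fun i _ => ht i).trans_eq (by simp)
    _ ≤ (6 * x ^ 2 + 24 + m ^ 2) * (L + 1 : ℝ) ^ 2 := by
        nlinarith [mul_le_mul_of_nonneg_left hL (by positivity : 0 ≤ 6 * (x : ℝ) ^ 2 + m ^ 2)]

/-- The momenta with a fixed component form a lattice of dimension four, on which the sum of
`1 / |p| ^ 4` diverges logarithmically. -/
theorem not_summable_barePropagator_sq (hm : m ≠ 0) (x : ℤ) :
    ¬ Summable fun r : {r : GaugeMomentum // r.1 0 = x} => barePropagator m r.1.1 ^ 2 := by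
  intro hsummable
  have hshell := (hsummable.comp_injective (i := fun s =>
    (⟨shellMomentum x s, shellMomentum_apply_zero x s⟩ : {r : GaugeMomentum // r.1 0 = x}))
    fun s s' h => shellMomentum_injective x (congrArg Subtype.val h)).sigma
  set A : ℝ := 6 * x ^ 2 + 24 + m ^ 2
  have hA : 0 < A := by positivity
  have hharmonic : Summable fun L : ℕ => 1 / A ^ 2 * (1 / ((L + 1 : ℕ) : ℝ)) := by
    refine hshell.of_nonneg_of_le (fun L => by positivity) fun L => ?_
    calc 1 / A ^ 2 * (1 / ((L + 1 : ℕ) : ℝ))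
        = ∑ _t : Fin 3 → Fin (L + 1), (1 / (A * (L + 1 : ℝ) ^ 2)) ^ 2 := by
          simp only [Finset.sum_const, Finset.card_univ, Fintype.card_pi_const, Fintype.card_fin,
            nsmul_eq_mul, Nat.cast_pow, Nat.cast_add, Nat.cast_one]
          field_simp
      _ ≤ _ := by
          rw [tsum_fintype]
          exact Finset.sum_le_sum fun t _ => pow_le_pow_left₀ (by positivity)
            (le_barePropagator_shellMomentum hm x L t) 2
  rw [summable_mul_left_iff (by positivity)] at hharmonic
  exact Real.not_summable_one_div_natCast
    ((summable_nat_add_iff (f := fun L : ℕ => 1 / (L : ℝ)) 1).1 hharmonic)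

end Propagator

/-! ### A divergent graph at each order -/

namespace FeynmanGraph

section Divergence

variable {n N : ℕ} {G : FeynmanGraph n N} {m M : ℝ} {ρ : ℕ}

variable (G) in
/-- The attribution of the momentum `r` to the disk `X` and of `q` to all the other disks. -/
def loopMomentum (X : G.Disk) (q r : Momentum) (d : Half n) : Momentum :=
  open Classical in if G.diskOf d = X then r else q

theorem isDiskMomentum_loopMomentum (X : G.Disk) {c : Fin 6} (hcolor : ∀ v, G.color v = c)
    {q r : GaugeMomentum} (hr : r.1 c = q.1 c) : G.IsDiskMomentum (G.loopMomentum X q.1 r.1) := by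
  refine ⟨fun d => ?_, fun d => ?_, fun d => ?_⟩
  · rw [loopMomentum]
    split_ifs
    exacts [r.2, q.2]
  · rw [loopMomentum, loopMomentum,
      diskOf_eq_iff.2 (Perm.sameCycle_apply_left.2 (Perm.SameCycle.refl _ d))]
  · rw [loopMomentum, loopMomentum, hcolor]
    split_ifs <;> simp only [hr]

theorem loopMomentum_mem_attributions {X : G.Disk} (hX : ∀ j, G.diskOf (G.cilium j) ≠ X)
    {c : Fin 6} (hcolor : ∀ v, G.color v = c) {q r : GaugeMomentum} (hr : r.1 c = q.1 c) :
    G.loopMomentum X q.1 r.1 ∈ G.attributions fun _ => q :=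
  ⟨isDiskMomentum_loopMomentum X hcolor hr, fun j => if_neg (hX j)⟩

theorem loopMomentum_injective (X : G.Disk) (q : Momentum) :
    Function.Injective (G.loopMomentum X q) := fun r r' h => by
  have hX : G.diskOf X.out = X := X.out_eq
  simpa only [loopMomentum, if_pos hX] using congrFun h X.out

theorem exists_mul_sq_le_weight_loopMomentum (hm : m ≠ 0) {X : G.Disk}
    (hX : Nat.card {d // G.diskOf d = X} ≤ 2) (q : Momentum) :
    ∃ C : ℝ, 0 < C ∧ ∀ r ρ, propagator m M ρ q = barePropagator m q →
      propagator m M ρ r = barePropagator m r →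
        C * barePropagator m r ^ 2 ≤ G.weight m M ρ (G.loopMomentum X q r) := by
  classical
  set a := Fintype.card {l : G.Line // G.diskOf l.1 = X} with ha_def
  set b := Fintype.card {l : G.Line // ¬ G.diskOf l.1 = X} with hb_def
  have ha : a ≤ 2 := by
    refine le_trans ?_ hX
    rw [ha_def, ← Nat.card_eq_fintype_card]
    exact Nat.card_le_card_of_injective (fun l => (⟨l.1.1, l.2⟩ : {d // G.diskOf d = X}))
      fun l l' h => Subtype.ext (Subtype.ext (congrArg (·.1) h))
  have hbare := barePropagator_pos hm
  refine ⟨(m ^ 2) ^ (2 - a) * barePropagator m q ^ b,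
    mul_pos (by positivity) (pow_pos (hbare q) b), fun r ρ hq hr => ?_⟩
  have hweight : G.weight m M ρ (G.loopMomentum X q r) =
      barePropagator m r ^ a * barePropagator m q ^ b := by
    simp only [weight, loopMomentum, apply_ite (propagator m M ρ), hq, hr, Finset.prod_ite,
      Finset.prod_const]
    rw [ha_def, hb_def, Fintype.card_subtype, Fintype.card_subtype]
  calc (m ^ 2) ^ (2 - a) * barePropagator m q ^ b * barePropagator m r ^ 2
      = (m ^ 2 * barePropagator m r) ^ (2 - a) *
          (barePropagator m r ^ a * barePropagator m q ^ b) := by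
        rw [← pow_sub_mul_pow (barePropagator m r) ha]
        ring
    _ ≤ barePropagator m r ^ a * barePropagator m q ^ b :=
        mul_le_of_le_one_left (mul_pos (pow_pos (hbare r) a) (pow_pos (hbare q) b)).le
          (pow_le_one₀ (mul_pos (by positivity) (hbare r)).le (sq_mul_barePropagator_le_one r))
    _ = _ := hweight.symm

/-- The momentum of a disk of length two without cilium is only constrained through its component
of the colour of the graph. -/
theorem tendsto_amplitude_atTop (hm : m ≠ 0) (hM : 1 < M) (hcolor : ∀ v, G.color v = 0)
    {X : G.Disk} (hcilium : ∀ j, G.diskOf (G.cilium j) ≠ X)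
    (hX : Nat.card {d // G.diskOf d = X} ≤ 2) (q : GaugeMomentum) :
    Tendsto (fun ρ => G.amplitude m M ρ fun _ => q) atTop atTop := by
  obtain ⟨C, hC, hweight⟩ := exists_mul_sq_le_weight_loopMomentum (M := M) hm hX q.1
  rw [tendsto_atTop]
  intro B
  obtain ⟨T, hT⟩ : ∃ T : Finset {r : GaugeMomentum // r.1 0 = q.1 0},
      B / C < ∑ r ∈ T, barePropagator m r.1.1 ^ 2 := by
    by_contra! hbounded
    exact not_summable_barePropagator_sq hm (q.1 0)
      (summable_of_sum_le (fun r => sq_nonneg _) hbounded)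
  filter_upwards [eventually_propagator_eq hM q,
    (Finset.eventually_all T).2 fun r _ => eventually_propagator_eq hM r.1] with ρ hq hr
  calc B ≤ C * ∑ r ∈ T, barePropagator m r.1.1 ^ 2 := ((div_lt_iff₀' hC).1 hT).le
    _ = ∑ r ∈ T, C * barePropagator m r.1.1 ^ 2 := Finset.mul_sum _ _ _
    _ ≤ ∑ r ∈ T, G.weight m M ρ (G.loopMomentum X q.1 r.1.1) :=
        Finset.sum_le_sum fun r hrT => hweight _ _ hq (hr r hrT)
    _ ≤ _ := sum_weight_le_amplitude
        ((loopMomentum_injective X q.1).comp (Subtype.val_injective.comp Subtype.val_injective)) T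
        fun r _ => loopMomentum_mem_attributions hcilium hcolor r.2

end Divergence

theorem monoLinked_of_color_eq {n N : ℕ} {G : FeynmanGraph n N} (h : IsConnectedMap G.wick)
    {c : Fin 6} (hcolor : ∀ v, G.color v = c) (d d' : Half n) : G.MonoLinked c d d' := by
  classical
  have hlink {e e' : Half n} (he : G.MonoLinked c e e') :
      G.MonoLinked c d e ↔ G.MonoLinked c d e' :=
    ⟨fun hde => (monoLinked_equivalence c).trans hde he,
      fun hde => (monoLinked_equivalence c).trans hde ((monoLinked_equivalence c).symm he)⟩
  have hindicator : (fun e => if G.MonoLinked c d e then 1 else 0) ∈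
      componentFunctions G.wick Finset.univ := by
    refine ⟨mem_invariants.2 fun e => ?_, mem_invariants_exchange.2 fun v _ => ?_⟩
    · rw [hlink (.of_sameCycle (Perm.sameCycle_apply_left.2 (Perm.SameCycle.refl _ e)))]
    · rw [hlink (hcolor v ▸ monoLinked_color (v, false))]
      rfl
  have hconst := h _ hindicator d d'
  simpa [(monoLinked_equivalence c).refl d] using hconst

end FeynmanGraph

section Chain

open FeynmanGraph

variable {k N : ℕ}

/-- The contraction that joins `(v, true)` to `(v + 1, false)`, both ways, and fixes the two ends
of the chain. -/
def chainWick (k : ℕ) : Perm (Half (k + 1)) :=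
  Function.Involutive.toPerm
    (fun d => if d.2 then Fin.lastCases (Fin.last k, true) (fun i => (i.succ, false)) d.1
      else Fin.cases (0, false) (fun i => (i.castSucc, true)) d.1) <| by
    rintro ⟨v, _ | _⟩
    · cases v using Fin.cases <;> simp
    · cases v using Fin.lastCases <;> simp

theorem chainWick_castSucc_true (i : Fin k) : chainWick k (i.castSucc, true) = (i.succ, false) :=
  Fin.lastCases_castSucc (motive := fun _ => Half (k + 1)) i

theorem chainWick_succ_false (i : Fin k) : chainWick k (i.succ, false) = (i.castSucc, true) := rfl

theorem chainWick_last_true : chainWick k (Fin.last k, true) = (Fin.last k, true) :=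
  Fin.lastCases_last (motive := fun _ => Half (k + 1))

theorem chainWick_zero_false : chainWick k (0, false) = (0, false) := rfl

/-- The rank along the chain of the disk through an arc. -/
def chainRank (d : Half (k + 1)) : Fin (k + 2) := if d.2 then d.1.succ else d.1.castSucc

theorem chainRank_chainWick (d : Half (k + 1)) : chainRank (chainWick k d) = chainRank d := by
  rcases d with ⟨v, _ | _⟩
  · cases v using Fin.cases with
    | zero => rw [chainWick_zero_false]
    | succ i =>
      rw [chainWick_succ_false]
      exact i.succ_castSucc
  · cases v using Fin.lastCases with
    | last => rw [chainWick_last_true]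
    | cast i =>
      rw [chainWick_castSucc_true]
      exact i.succ_castSucc.symm

theorem chainRank_surjective : Function.Surjective (chainRank (k := k)) := fun i => by
  cases i using Fin.lastCases with
  | last => exact ⟨(Fin.last k, true), Fin.succ_last k⟩
  | cast v => exact ⟨(v, false), rfl⟩

/-- The chain of `k + 1` wavy edges of colour `0` between `k + 2` disks, with a cilium on the first
disk if `N = 1` and on both end disks if `N = 2`. -/
def chain (k : ℕ) {N : ℕ} (hN : N ≤ 2) : FeynmanGraph (k + 1) N where
  color _ := 0
  wick := chainWick k
  cilium j := if (j : ℕ) = 0 then (0, false) else (Fin.last k, true)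
  eq_of_sameCycle i j h := by
    have hrank := apply_eq_of_sameCycle chainRank_chainWick h
    have hends : chainRank (0, false) ≠ chainRank (Fin.last k, true) := by
      simp [chainRank]
    ext
    split_ifs at hrank <;> omega

variable {hN : N ≤ 2}

theorem wick_cilium_chain (j : Fin N) :
    (chain k hN).wick ((chain k hN).cilium j) = (chain k hN).cilium j := by
  simp only [chain]
  split_ifs
  exacts [chainWick_zero_false, chainWick_last_true]

theorem vertexGraph_chain_connected {S : Set (Half (k + 1))}
    (hS : ∀ i : Fin k, (i.castSucc, true) ∈ S ∨ (i.succ, false) ∈ S) :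
    ((chain k hN).vertexGraph S).Connected := by
  have hadj (i : Fin k) : ((chain k hN).vertexGraph S).Adj i.castSucc i.succ :=
    (SimpleGraph.fromRel_adj _ _ _).2 ⟨Fin.castSucc_lt_succ.ne, (hS i).imp
      (fun hi => ⟨_, hi, rfl, congrArg Prod.fst (chainWick_castSucc_true i)⟩)
      (fun hi => ⟨_, hi, rfl, congrArg Prod.fst (chainWick_succ_false i)⟩)⟩
  have hreachable (v : Fin (k + 1)) : ((chain k hN).vertexGraph S).Reachable 0 v := by
    induction v using Fin.induction with
    | zero => exact .refl 0
    | succ i ih => exact ih.trans (hadj i).reachable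
  exact ⟨fun v u => (hreachable v).symm.trans (hreachable u)⟩

theorem isOnePI_chain : (chain k hN).IsOnePI := by
  have hinternal {d d' : Half (k + 1)} (hd : chainWick k d = d') (hne : d' ≠ d) :
      d ∉ Set.range (chain k hN).cilium := by
    rintro ⟨j, rfl⟩
    exact hne (hd.symm.trans (wick_cilium_chain j))
  have htrue (i : Fin k) := hinternal (chainWick_castSucc_true i) (by simp)
  have hfalse (i : Fin k) := hinternal (chainWick_succ_false i) (by simp)
  refine ⟨vertexGraph_chain_connected fun i => .inl (htrue i),
    fun l _ => vertexGraph_chain_connected fun i => ?_⟩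
  by_cases hl : (i.castSucc, true) = l
  · exact .inr ⟨hfalse i, by simp [← hl]⟩
  · exact .inl ⟨htrue i, hl⟩

theorem isMelonic_chain : (chain k hN).IsMelonic := by
  have hconnected := (isOnePI_chain (k := k) (hN := hN)).isConnectedMap
  rw [isMelonic_iff _ hconnected]
  refine le_antisymm (hconnected.numCycles_le.trans_eq (by rw [Fintype.card_fin])) ?_
  exact (Nat.card_fin (k + 2)).ge.trans
    (card_le_numCycles chainRank_chainWick chainRank_surjective)

theorem isMono_chain : (chain k le_rfl).IsMono 0 :=
  monoLinked_of_color_eq isOnePI_chain.isConnectedMap (fun _ => rfl) _ _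

theorem tendsto_amplitude_chain {m M : ℝ} (hm : m ≠ 0) (hM : 1 < M) (hk : N ≤ k + 1)
    (q : GaugeMomentum) :
    Tendsto (fun ρ => (chain k hN).amplitude m M ρ fun _ => q) atTop atTop := by
  have hrank {d d' : Half (k + 1)} (h : (chain k hN).diskOf d = (chain k hN).diskOf d') :
      chainRank d = chainRank d' :=
    apply_eq_of_sameCycle chainRank_chainWick (diskOf_eq_iff.1 h)
  refine tendsto_amplitude_atTop (X := (chain k hN).diskOf (0, true)) hm hM (fun _ => rfl)
    (fun j hj => ?_) ?_ q
  · have hcilium := hrank hj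
    simp only [chain] at hcilium
    split_ifs at hcilium <;> simp [chainRank, Fin.ext_iff] at hcilium
    omega
  · refine (Nat.card_le_card_of_injective (fun d => d.1.2) fun d d' h => ?_).trans_eq
      (Nat.card_eq_fintype_card.trans Fintype.card_bool)
    have hd := (hrank d.2).trans (hrank d'.2).symm
    rcases d with ⟨⟨v, b⟩, _⟩
    rcases d' with ⟨⟨v', b'⟩, _⟩
    obtain rfl : b = b' := h
    cases b <;> simpa [chainRank] using hd

end Chain

/-! ### Vertex functions -/

section VertexFunctions

open FeynmanGraph PowerSeries

variable {m M : ℝ} {n N : ℕ}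

section FeynmanSum

variable {S : GraphClass N} {ρ : ℕ} {p : Fin N → GaugeMomentum}

/-- The sum of the amplitudes of the graphs of order `n` of the class `S`. -/
def amplitudeSum (m M : ℝ) (S : GraphClass N) (ρ : ℕ) (p : Fin N → GaugeMomentum) (n : ℕ) : ℝ :=
  ∑ G : FeynmanGraph n N, (S n).indicator (fun G => G.amplitude m M ρ p) G

theorem coeff_feynmanSum :
    coeff n (feynmanSum m M S ρ p) = (-1) ^ n / (n.factorial : ℝ) * amplitudeSum m M S ρ p n := by
  classical
  simp only [feynmanSum, coeff_mk, amplitudeSum, Set.indicator_apply]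

theorem amplitude_le_amplitudeSum {G : FeynmanGraph n N} (hG : G ∈ S n) :
    G.amplitude m M ρ p ≤ amplitudeSum m M S ρ p n := by
  rw [← Set.indicator_of_mem hG fun G => G.amplitude m M ρ p]
  exact Finset.single_le_sum (f := (S n).indicator fun G => G.amplitude m M ρ p)
    (fun G _ => Set.indicator_nonneg (fun _ _ => amplitude_nonneg) G) (Finset.mem_univ G)

theorem constantCoeff_feynmanSum (hN : N ≠ 0) : constantCoeff (feynmanSum m M S ρ p) = 0 := by
  have : IsEmpty (FeynmanGraph 0 N) := ⟨fun G => (G.cilium ⟨0, hN.bot_lt⟩).1.elim0⟩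
  rw [← coeff_zero_eq_constantCoeff_apply, coeff_feynmanSum, amplitudeSum, Finset.univ_eq_empty,
    Finset.sum_empty, mul_zero]

theorem feynmanSum_eq_zero (h : ∀ n, ∀ G ∈ S n, G.amplitude m M ρ p = 0) :
    feynmanSum m M S ρ p = 0 := by
  ext n
  rw [coeff_feynmanSum, amplitudeSum, map_zero, Finset.sum_eq_zero, mul_zero]
  exact fun G _ => Set.indicator_apply_eq_zero.2 (h n G)

theorem feynmanSum_congr {S' : GraphClass N} {p' : Fin N → GaugeMomentum}
    (e : ∀ n, FeynmanGraph n N ≃ FeynmanGraph n N) (hS : ∀ n G, e n G ∈ S' n ↔ G ∈ S n)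
    (he : ∀ n, ∀ G ∈ S n, G.amplitude m M ρ p = (e n G).amplitude m M ρ p') :
    feynmanSum m M S ρ p = feynmanSum m M S' ρ p' := by
  classical
  ext n
  rw [coeff_feynmanSum, coeff_feynmanSum, amplitudeSum, amplitudeSum]
  congr 1
  refine Fintype.sum_equiv (e n) _ _ fun G => ?_
  rw [Set.indicator_apply, Set.indicator_apply, hS]
  exact ite_congr rfl (he n G) fun _ => rfl

variable (m M) in
theorem feynmanSum_sub {T : GraphClass N} (h : ∀ n, T n ⊆ S n) :
    feynmanSum m M S - feynmanSum m M T = feynmanSum m M (S \ T) := by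
  ext ρ p n
  simp only [Pi.sub_apply, map_sub, coeff_feynmanSum, amplitudeSum, Pi.sdiff_apply,
    Set.indicator_sdiff (h n), Finset.sum_sub_distrib, mul_sub]

variable (m M) in
theorem sum_feynmanSum {ι : Type*} [Fintype ι] {T : ι → GraphClass N}
    (h : ∀ n, Pairwise fun i j => Disjoint (T i n) (T j n)) :
    ∑ i, feynmanSum m M (T i) = feynmanSum m M fun n => ⋃ i, T i n := by
  ext ρ p n
  have hunion := Finset.indicator_biUnion Finset.univ (fun i => T i n)
    (f := fun G => G.amplitude m M ρ p) fun i _ j _ hij => h n hij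
  simp only [Finset.mem_univ, Set.iUnion_true] at hunion
  simp only [Finset.sum_apply, map_sum, coeff_feynmanSum, amplitudeSum, hunion]
  rw [← Finset.mul_sum, Finset.sum_comm]

end FeynmanSum

section StrandSeries

/-- The sum of the graphs of the class `S` stripped of a factor `-λ`, as a function of the
component of colour `0` that the momenta of all the cilia share. -/
def strandSeries (m M : ℝ) (S : GraphClass N) (ρ : ℕ) (q : ℤ) : PowerSeries ℝ :=
  mk fun k => -coeff (k + 1) (feynmanSum m M S ρ fun _ => strandMomentum q)

theorem feynmanSum_strandMomentum (hN : N ≠ 0) (S : GraphClass N) (ρ : ℕ) (q : ℤ) :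
    feynmanSum m M S ρ (fun _ => strandMomentum q) = -(X * strandSeries m M S ρ q) := by
  ext n
  cases n with
  | zero => simp [constantCoeff_feynmanSum hN]
  | succ k => rw [map_neg, coeff_succ_X_mul, strandSeries, coeff_mk, neg_neg]

theorem divergesAtOrder_strandSeries (hm : m ≠ 0) (hM : 1 < M) (hN : N ≤ 2) {S : GraphClass N}
    {k : ℕ} (hk : N ≤ k + 1) (hS : chain k hN ∈ S (k + 1)) (q : ℤ) :
    DivergesAtOrder (fun ρ => strandSeries m M S ρ q) k := by
  have hfactorial : 0 < 1 / ((k + 1).factorial : ℝ) := by positivity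
  refine tendsto_atTop_mono (fun ρ => ?_)
    ((tendsto_amplitude_chain (hN := hN) hm hM hk (strandMomentum q)).const_mul_atTop hfactorial)
  beta_reduce
  rw [strandSeries, coeff_mk, coeff_feynmanSum, abs_neg, abs_mul, abs_div, abs_pow, abs_neg,
    abs_one, one_pow, Nat.abs_cast]
  gcongr
  exact (amplitude_le_amplitudeSum hS).trans (le_abs_self _)

/-- The one-particle irreducible melonic graphs whose ciliated disks, which are leaves, all have
an edge of colour `c`. -/
def onePIMelonicRoot (N : ℕ) (c : Fin 6) : GraphClass N :=
  fun _ => {G | G.IsOnePI ∧ G.IsMelonic ∧ ∀ j, G.color (G.cilium j).1 = c}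

theorem chain_mem_onePIMelonicRoot (k : ℕ) (hN : N ≤ 2) :
    chain k hN ∈ onePIMelonicRoot N 0 (k + 1) :=
  ⟨isOnePI_chain, isMelonic_chain, fun _ => rfl⟩

theorem chain_mem_onePIMelonicMono (k : ℕ) : chain k le_rfl ∈ onePIMelonicMono 0 (k + 1) :=
  ⟨isOnePI_chain, isMelonic_chain, isMono_chain⟩

theorem recolor_mem_onePIMelonicRoot (π : Perm (Fin 6)) (c : Fin 6) (G : FeynmanGraph n N) :
    recolor π G ∈ onePIMelonicRoot N (π c) n ↔ G ∈ onePIMelonicRoot N c n :=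
  and_congr_right fun h : G.IsOnePI => and_congr (h.isMelonic_recolor π)
    (forall_congr' fun _ => π.injective.eq_iff)

theorem recolor_mem_onePIMelonicMono (π : Perm (Fin 6)) (c : Fin 6) (G : FeynmanGraph n 2) :
    recolor π G ∈ onePIMelonicMono (π c) n ↔ G ∈ onePIMelonicMono c n :=
  and_congr_right fun h : G.IsOnePI => and_congr (h.isMelonic_recolor π) (isMono_recolor π c)

theorem iUnion_onePIMelonicRoot_one :
    (fun n => ⋃ c, onePIMelonicRoot 1 c n) = onePIMelonic 1 := by
  ext n G
  simp [onePIMelonicRoot, onePIMelonic]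

theorem pairwise_disjoint_onePIMelonicRoot [NeZero N] :
    Pairwise fun c c' => Disjoint (onePIMelonicRoot N c n) (onePIMelonicRoot N c' n) :=
  fun _ _ hne => Set.disjoint_left.2 fun _ h h' => hne ((h.2.2 0).symm.trans (h'.2.2 0))

theorem onePIMelonicMono_subset (c : Fin 6) :
    onePIMelonicMono c n ⊆ onePIMelonicRoot 2 c n :=
  fun _ h => ⟨h.1, h.2.1, h.1.color_cilium h.2.1 h.2.2⟩

theorem pairwise_disjoint_onePIMelonicMono :
    Pairwise fun c c' => Disjoint (onePIMelonicMono c n) (onePIMelonicMono c' n) :=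
  fun _ _ hne => (pairwise_disjoint_onePIMelonicRoot hne).mono (onePIMelonicMono_subset _)
    (onePIMelonicMono_subset _)

theorem feynmanSum_eq_strandSeries (hN : N ≠ 0) {T : Fin 6 → GraphClass N}
    (hrecolor : ∀ (π : Perm (Fin 6)) c n (G : FeynmanGraph n N),
      recolor π G ∈ T (π c) n ↔ G ∈ T c n)
    (hroot : ∀ c n, T c n ⊆ onePIMelonicRoot N c n) {c : Fin 6} {p : Fin N → GaugeMomentum} {q : ℤ}
    (hp : ∀ j, (p j).1 c = q) (ρ : ℕ) :
    feynmanSum m M (T c) ρ p = -(X * strandSeries m M (T 0) ρ q) := by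
  rw [← feynmanSum_strandMomentum hN]
  refine feynmanSum_congr (fun n => recolor (swap c 0)) (fun n G => ?_) fun n G hG => ?_
  · simpa using hrecolor (swap c 0) c n G
  · obtain ⟨hirreducible, hmelonic, hcolor⟩ := hroot c n hG
    exact hirreducible.amplitude_eq_strandMomentum hmelonic hcolor hp m M ρ

variable (m M)

theorem vertexTwoMelo_eq (ρ : ℕ) (p : GaugeMomentum) :
    vertexTwoMelo m M ρ (fun _ => p) =
      -(X * ∑ c, strandSeries m M (onePIMelonicRoot 1 0) ρ (p.1 c)) := by
  rw [vertexTwoMelo, ← iUnion_onePIMelonicRoot_one,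
    ← sum_feynmanSum m M fun n => pairwise_disjoint_onePIMelonicRoot, Finset.sum_apply,
    Finset.sum_apply, Finset.mul_sum, ← Finset.sum_neg_distrib]
  exact Finset.sum_congr rfl fun c _ => feynmanSum_eq_strandSeries one_ne_zero
    (fun π c n G => recolor_mem_onePIMelonicRoot π c G) (fun _ _ => subset_rfl) (fun _ => rfl) ρ

theorem vertexFourMonoMelo_eq (ρ : ℕ) (c : Fin 6) (p p' : GaugeMomentum) :
    vertexFourMonoMelo m M c ρ ![p, p'] =
      -(X * (if p.1 c = p'.1 c then 1 else 0) *
        strandSeries m M (onePIMelonicMono 0) ρ (p.1 c)) := by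
  split_ifs with hp
  · rw [mul_one]
    refine feynmanSum_eq_strandSeries two_ne_zero
      (fun π c n G => recolor_mem_onePIMelonicMono π c G) (fun c _ => onePIMelonicMono_subset c)
      (fun j => ?_) ρ
    fin_cases j
    exacts [rfl, hp.symm]
  · rw [mul_zero, zero_mul, neg_zero]
    exact feynmanSum_eq_zero fun n G hG => MonoLinked.amplitude_eq_zero hG.2.2 hp

end StrandSeries

section SuperficialConvergence

variable (m M)

theorem isSuperficiallyConvergent_sub {S T : GraphClass N} (hTS : ∀ n, T n ⊆ S n)
    (hdegree : ∀ n, ∀ G ∈ S n, G ∉ T n → G.divergenceDegree < 0) :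
    IsSuperficiallyConvergent m M (S \ T) (feynmanSum m M S - feynmanSum m M T) :=
  ⟨feynmanSum_sub m M hTS, fun n G hG => hdegree n G hG.1 hG.2⟩

theorem isSuperficiallyConvergent_vertexTwo_sub_melo :
    IsSuperficiallyConvergent m M (onePI 1 \ onePIMelonic 1)
      (vertexFunction m M 1 - vertexTwoMelo m M) :=
  isSuperficiallyConvergent_sub m M (fun _ _ h => h.1) fun _ G hG hmelonic =>
    G.divergenceDegree_neg_of_not_isMelonic hG.isConnectedMap one_ne_zero
      fun h => hmelonic ⟨hG, h⟩

theorem isSuperficiallyConvergent_vertexFourMono_sub_melo (c : Fin 6) :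
    IsSuperficiallyConvergent m M (onePIMono c \ onePIMelonicMono c)
      (vertexFourMono m M c - vertexFourMonoMelo m M c) :=
  isSuperficiallyConvergent_sub m M (fun _ _ h => ⟨h.1, h.2.2⟩) fun _ G hG hmelonic =>
    G.divergenceDegree_neg_of_not_isMelonic hG.1.isConnectedMap two_ne_zero
      fun h => hmelonic ⟨hG.1, h, hG.2⟩

theorem isSuperficiallyConvergent_vertexFour_sub_sum_monoMelo :
    IsSuperficiallyConvergent m M (onePI 2 \ fun n => ⋃ c, onePIMelonicMono c n)
      (vertexFunction m M 2 - ∑ c, vertexFourMonoMelo m M c) := by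
  have hsum : ∑ c, vertexFourMonoMelo m M c = _ :=
    sum_feynmanSum m M fun n => pairwise_disjoint_onePIMelonicMono
  rw [hsum]
  refine isSuperficiallyConvergent_sub m M (fun n => Set.iUnion_subset fun c G hG => hG.1)
    fun n G hG hexcluded => ?_
  by_cases hmelonic : G.IsMelonic
  · exact G.divergenceDegree_neg_of_not_isMono hG.isConnectedMap fun c hmono =>
      hexcluded (Set.mem_iUnion.2 ⟨c, hG, hmelonic, hmono⟩)
  · exact G.divergenceDegree_neg_of_not_isMelonic hG.isConnectedMap two_ne_zero hmelonic

theorem isSuperficiallyConvergent_vertexFunction (hN : 3 ≤ N) :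
    IsSuperficiallyConvergent m M (onePI N) (vertexFunction m M N) :=
  ⟨rfl, fun _ G hG => G.divergenceDegree_neg_of_three_le hG.isConnectedMap hN⟩

end SuperficialConvergence

end VertexFunctions

end

end TGFT

theorem mainTheorem2 (m M : ℝ) (hm : 0 < m) (hM : 1 < M) :
    (∃ f g : ℕ → ℤ → PowerSeries ℝ,
      (∀ (p : ℤ) (k : ℕ), TGFT.DivergesAtOrder (fun ρ => f ρ p) k) ∧
      (∀ (p : ℤ) (k : ℕ), 1 ≤ k → TGFT.DivergesAtOrder (fun ρ => g ρ p) k) ∧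
      (∀ (ρ : ℕ) (p : TGFT.GaugeMomentum),
        TGFT.vertexTwoMelo m M ρ (fun _ => p) = -(PowerSeries.X * ∑ c, f ρ (p.1 c))) ∧
      (∀ (ρ : ℕ) (c : Fin 6) (p p' : TGFT.GaugeMomentum),
        TGFT.vertexFourMonoMelo m M c ρ ![p, p'] =
          -(PowerSeries.X * (if p.1 c = p'.1 c then 1 else 0) * g ρ (p.1 c)))) ∧
    TGFT.IsSuperficiallyConvergent m M (TGFT.onePI 1 \ TGFT.onePIMelonic 1)
      (TGFT.vertexFunction m M 1 - TGFT.vertexTwoMelo m M) ∧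
    (∀ c : Fin 6,
      TGFT.IsSuperficiallyConvergent m M (TGFT.onePIMono c \ TGFT.onePIMelonicMono c)
        (TGFT.vertexFourMono m M c - TGFT.vertexFourMonoMelo m M c)) ∧
    TGFT.IsSuperficiallyConvergent m M
      (TGFT.onePI 2 \ fun n => ⋃ c, TGFT.onePIMelonicMono c n)
      (TGFT.vertexFunction m M 2 - ∑ c, TGFT.vertexFourMonoMelo m M c) ∧
    (∀ N : ℕ, 3 ≤ N →
      TGFT.IsSuperficiallyConvergent m M (TGFT.onePI N) (TGFT.vertexFunction m M N)) := by
  refine ⟨⟨TGFT.strandSeries m M (TGFT.onePIMelonicRoot 1 0),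
      TGFT.strandSeries m M (TGFT.onePIMelonicMono 0), fun p k => ?_, fun p k hk => ?_,
      TGFT.vertexTwoMelo_eq m M, TGFT.vertexFourMonoMelo_eq m M⟩,
    TGFT.isSuperficiallyConvergent_vertexTwo_sub_melo m M,
    TGFT.isSuperficiallyConvergent_vertexFourMono_sub_melo m M,
    TGFT.isSuperficiallyConvergent_vertexFour_sub_sum_monoMelo m M,
    fun N hN => TGFT.isSuperficiallyConvergent_vertexFunction m M hN⟩
  · exact TGFT.divergesAtOrder_strandSeries hm.ne' hM one_le_two (Nat.le_add_left 1 k)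
      (TGFT.chain_mem_onePIMelonicRoot k one_le_two) p
  · exact TGFT.divergesAtOrder_strandSeries hm.ne' hM le_rfl (Nat.succ_le_succ hk)
      (TGFT.chain_mem_onePIMelonicMono k) p
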